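/- Let $q\ge 1$ and $t>0$. Let $\mathcal H$ be the Hilbert space of (complex-valued) square integrable differential forms of all degrees on $\mathbb R^q$, let $d$ be the exterior derivative, $d^*$ its adjoint, and $D=d+d^*$ the self-adjoint Dirac operator. Let $\phi_{n}$ denote the unique solution of $\phi''(r)+(n-1)\phi'(r)/r+\phi(r)=0$, $\phi(0)=1$, $\phi'(0)=0$. Then $t\,\phi_{q+2}(tD)\,d$, where $\phi_{q+2}(tD)$ is given by the functional calculus of $D$ and where the operator is first defined on rapidly decreasing smooth forms, extends uniquely to a bounded operator $d_t$ on $\mathcal H$. Let $f$ be a continuous $(q-1)$-form on $\mathbb R^q$. For $p\in\mathbb R^q$ let $W_t(p)$ be the sphere of radius $t$ centered at $p$, oriented by the outward normal, with surface area $|W_t(p)|$ (for $q=1$: the two points $p\pm t$ with counting measure), and define the $q$-form $$u(p)=q\cdot\Big(\frac{1}{|W_t(p)|}\int_{W_t(p)} f\Big)\,dx_1\wedge\dots\wedge dx_q ,$$ that is, $q$ times the average flux of $f$ through $W_t(p)$. Then $u$ is continuous and $d_tf=u$, in the following sense: if $f$ is square integrable, then $u$ is the continuous representative of $d_tf\in\mathcal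 H$; and for an arbitrary continuous $f$, $d_tf=u$ in the sense of distributions, i.e. for every smooth compactly supported form $\psi$ the integral $\int_{\mathbb R^q}\langle d_t^*\psi,f\rangle\,dx$ (with $d_t^*$ the adjoint of the bounded operator $d_t$) converges absolutely and equals $\int_{\mathbb R^q}\langle\psi,u\rangle\,dx$. -/

import Mathlib

open MeasureTheory SchwartzMap
open scoped FourierTransform LineDeriv Real

/-! ### Differential forms on `ℝ^q` and the Dirac operator -/

/-- Euclidean space `ℝ^q`. -/
abbrev Space (q : ℕ) := EuclideanSpace ℝ (Fin q)

/-- The exterior algebra `⨁ₖ Λᵏ(ℝ^q)* ⊗ ℂ` with its Hermitian inner product, written in the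
orthonormal basis `dx_I = dx_{i₁} ∧ … ∧ dx_{iₖ}`, where `I = {i₁ < … < iₖ}` runs over the subsets
of the index set.  The degree of `dx_I` is the number of elements of `I`. -/
abbrev FormFiber (q : ℕ) := EuclideanSpace ℂ (Finset (Fin q))

/-- The Hilbert space of square integrable differential forms (of all degrees) on `ℝ^q`. -/
noncomputable abbrev FormL2 (q : ℕ) := Lp (FormFiber q) 2 (volume : Measure (Space q))

/-- The `i`-th standard basis vector of `ℝ^q`. -/
noncomputable abbrev stdVec {q : ℕ} (i : Fin q) : Space q := EuclideanSpace.single i (1 : ℝ)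

/-- Exterior multiplication `ω ↦ dx_i ∧ ω`: it sends `dx_J` with `i ∉ J` to
`(-1)^{#{j ∈ J : j < i}} dx_{J ∪ {i}}`, and `dx_J` with `i ∈ J` to `0`. -/
noncomputable def wedge {q : ℕ} (i : Fin q) : FormFiber q →L[ℂ] FormFiber q :=
  LinearMap.toContinuousLinearMap
    { toFun := fun ω => WithLp.toLp 2 fun I =>
        if i ∈ I then (-1 : ℂ) ^ (I.filter (· < i)).card * ω (I.erase i) else 0
      map_add' := by
        intro x y
        ext I
        by_cases h : i ∈ I <;> simp [h, mul_add]
      map_smul' := by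
        intro c x
        ext I
        by_cases h : i ∈ I <;> simp [h, mul_left_comm] }

/-- Interior multiplication `ω ↦ ι_{e_i} ω`, the adjoint of `ω ↦ dx_i ∧ ω`. -/
noncomputable def contract {q : ℕ} (i : Fin q) : FormFiber q →L[ℂ] FormFiber q :=
  ContinuousLinearMap.adjoint (wedge i)

/-- The exterior derivative `d ω = ∑ᵢ dx_i ∧ ∂ᵢ ω` on rapidly decreasing smooth forms. -/
noncomputable def extD {q : ℕ} (ω : 𝓢(Space q, FormFiber q)) : 𝓢(Space q, FormFiber q) :=
  ∑ i, postcompCLM (wedge i) (∂_{stdVec i} ω)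

/-- The codifferential `d* ω = -∑ᵢ ι_{e_i} ∂ᵢ ω`, the formal adjoint of `d`. -/
noncomputable def codiff {q : ℕ} (ω : 𝓢(Space q, FormFiber q)) : 𝓢(Space q, FormFiber q) :=
  -∑ i, postcompCLM (contract i) (∂_{stdVec i} ω)

/-- The Dirac operator `D = d + d*`. -/
noncomputable def dirac {q : ℕ} (ω : 𝓢(Space q, FormFiber q)) : 𝓢(Space q, FormFiber q) :=
  extD ω + codiff ω

/-- The symbol `σ(ξ) = ∑ᵢ 2πi ξ_i (dx_i ∧ · - ι_{e_i})` of the Dirac operator, a self-adjoint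
endomorphism of the fiber. -/
noncomputable def diracSymbol {q : ℕ} (ξ : Space q) : FormFiber q →L[ℂ] FormFiber q :=
  ∑ i, (2 * π * Complex.I * (ξ i : ℂ)) • (wedge i - contract i)

theorem isSelfAdjoint_diracSymbol {q : ℕ} (ξ : Space q) : IsSelfAdjoint (diracSymbol ξ) := by
  rw [isSelfAdjoint_iff, ContinuousLinearMap.star_eq_adjoint, diracSymbol, map_sum]
  refine Finset.sum_congr rfl fun i _ => ?_
  rw [map_smulₛₗ, map_sub, contract, ContinuousLinearMap.adjoint_adjoint,
    ← neg_sub (wedge i), smul_neg, ← neg_smul]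
  congr 1
  simp only [map_mul, Complex.conj_ofReal, Complex.conj_I, Complex.conj_ofNat]
  ring

/-- The Fourier transform diagonalizes `D`: it turns `D` into multiplication by the symbol. -/
theorem fourier_dirac {q : ℕ} (ω : 𝓢(Space q, FormFiber q)) (ξ : Space q) :
    𝓕 (dirac ω) ξ = diracSymbol ξ (𝓕 ω ξ) := by
  have hp : ∀ (L : FormFiber q →L[ℂ] FormFiber q) (η : 𝓢(Space q, FormFiber q)),
      𝓕 (postcompCLM L η) = postcompCLM L (𝓕 η) := by
    intro L η
    ext1 ξ
    rw [postcompCLM_apply, SchwartzMap.fourier_coe, SchwartzMap.fourier_coe, Real.fourier_eq,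
      Real.fourier_eq, ← L.integral_comp_comm]
    · congr 1
      ext1 v
      rw [postcompCLM_apply, Circle.smul_def, Circle.smul_def, map_smul]
    · rw [Real.fourierIntegral_convergent_iff]
      exact η.integrable
  have hd : ∀ i : Fin q, 𝓕 (∂_{stdVec i} ω) ξ = (2 * π * Complex.I * (ξ i : ℂ)) • 𝓕 ω ξ := by
    intro i
    have ht : (inner ℝ · (stdVec i) : Space q → ℝ).HasTemperateGrowth :=
      ((innerSL ℝ).flip (stdVec i)).hasTemperateGrowth
    rw [fourier_lineDerivOp_eq, _root_.smul_apply, smulLeftCLM_apply_apply ht]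
    have hi : inner ℝ ξ (stdVec i) = ξ i := by simp [EuclideanSpace.inner_single_right]
    rw [hi, mul_smul (2 * π * Complex.I : ℂ), Complex.coe_smul]
  have hneg : ∀ η : 𝓢(Space q, FormFiber q), 𝓕 (-η) = -𝓕 η := fun η =>
    (FourierTransform.fourierCLM ℂ 𝓢(Space q, FormFiber q)).map_neg η
  simp only [dirac, extD, codiff, FourierTransform.fourier_add, hneg,
    FourierTransform.fourier_sum, hp, _root_.add_apply, _root_.neg_apply,
    _root_.sum_apply, postcompCLM_apply, hd, diracSymbol, _root_.sum_apply,
    _root_.smul_apply, _root_.sub_apply, map_smul, smul_sub,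
    Finset.sum_sub_distrib]
  rw [sub_eq_add_neg]

/-- `d*` is the formal adjoint of `d`. -/
theorem integral_inner_extD {q : ℕ} (ω η : 𝓢(Space q, FormFiber q)) :
    ∫ x, inner ℂ (extD ω x) (η x) = ∫ x, inner ℂ (ω x) (codiff η x) := by
  let B : FormFiber q →L[ℝ] FormFiber q →L[ℝ] ℂ :=
    (isBoundedBilinearMap_inner (𝕜 := ℂ) (E := FormFiber q)).toContinuousLinearMap
  let L : Fin q → FormFiber q →L[ℝ] FormFiber q →L[ℝ] ℂ := fun i =>
    B.comp ((wedge i).restrictScalars ℝ)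
  have hL : ∀ i x y, L i x y = inner ℂ (wedge i x) y := fun _ _ _ => rfl
  have hL' : ∀ i x y, L i x y = inner ℂ x (contract i y) := fun i x y =>
    (ContinuousLinearMap.adjoint_inner_right (wedge i) x y).symm
  have hint : ∀ i (a b : 𝓢(Space q, FormFiber q)), Integrable fun x => L i (a x) (b x) :=
    fun i a b => (bilinLeftCLM (L i) b.hasTemperateGrowth a).integrable
  have h1 : ∀ x, inner ℂ (extD ω x) (η x) = ∑ i, L i (∂_{stdVec i} ω x) (η x) := by
    intro x
    simp only [extD, _root_.sum_apply, postcompCLM_apply, sum_inner, hL]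
  have h2 : ∀ x, inner ℂ (ω x) (codiff η x) = ∑ i, -L i (ω x) (∂_{stdVec i} η x) := by
    intro x
    simp only [codiff, _root_.neg_apply, _root_.sum_apply, postcompCLM_apply,
      inner_neg_right, inner_sum, hL', Finset.sum_neg_distrib]
  simp only [h1, h2]
  rw [integral_finsetSum _ fun i _ => hint i _ _,
    integral_finsetSum _ fun i _ => (hint i ω (∂_{stdVec i} η)).fun_neg]
  refine Finset.sum_congr rfl fun i _ => ?_
  rw [integral_neg, integral_bilinear_lineDerivOp_right_eq_neg_left, neg_neg]

/-- The functional calculus of the self-adjoint operator `D` on `L²` forms: the bounded operator `B`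
is `g(D)`.  The Fourier transform is a unitary equivalence between `D` and multiplication by the
self-adjoint matrix `σ(ξ)`, so `g(D)` corresponds to multiplication by the matrix `g(σ(ξ))`. -/
def IsFunctionOfDirac {q : ℕ} (g : ℝ → ℝ) (B : FormL2 q →L[ℂ] FormL2 q) : Prop :=
  ∀ f : FormL2 q, ∀ᵐ ξ, (𝓕 (B f) : FormL2 q) ξ = cfc g (diracSymbol ξ) ((𝓕 f : FormL2 q) ξ)

/-! ### The Bessel functions and the deformed exterior derivative -/

/-- `φ` is a solution of the Bessel type equation `φ'' + (n - 1) φ' / r + φ = 0` with `φ(0) = 1` and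
`φ'(0) = 0`. -/
structure IsBesselSolution (n : ℕ) (φ : ℝ → ℝ) : Prop where
  contDiff : ContDiff ℝ 2 φ
  map_zero : φ 0 = 1
  deriv_zero : deriv φ 0 = 0
  ode : ∀ r, r ≠ 0 → deriv (deriv φ) r + (n - 1) * (deriv φ r / r) + φ r = 0

/-- The Bessel function `φ_n(r) = ∑ₖ r^{2k} / ∏_{j=1}^{k} (-2j)(n - 2 + 2j)`. -/
noncomputable def besselPhi (n : ℕ) (r : ℝ) : ℝ :=
  ∑' k : ℕ, r ^ (2 * k) / ∏ j ∈ Finset.Icc 1 k, (-2 * (j : ℝ)) * ((n : ℝ) - 2 + 2 * j)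

theorem summable_powerSeries {c : ℕ → ℝ} (hc : ∀ k, |c k| ≤ 1 / k.factorial) (x : ℝ) :
    Summable fun k => c k * x ^ k := by
  refine Summable.of_norm_bounded (Real.summable_pow_div_factorial |x|) fun k => ?_
  rw [Real.norm_eq_abs, abs_mul, abs_pow, div_eq_inv_mul, ← one_div]
  exact mul_le_mul_of_nonneg_right (hc k) (by positivity)

theorem coeff_deriv_le {c : ℕ → ℝ} (hc : ∀ k, |c k| ≤ 1 / k.factorial) (k : ℕ) :
    |((k : ℝ) + 1) * c (k + 1)| ≤ 1 / k.factorial := by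
  have h := hc (k + 1)
  rw [Nat.factorial_succ] at h
  push_cast at h
  rw [abs_mul, abs_of_pos (by positivity : (0 : ℝ) < k + 1)]
  calc ((k : ℝ) + 1) * |c (k + 1)| ≤ (k + 1) * (1 / ((k + 1) * k.factorial)) := by gcongr
    _ = 1 / k.factorial := by field_simp

theorem hasDerivAt_powerSeries {c : ℕ → ℝ} (hc : ∀ k, |c k| ≤ 1 / k.factorial) (x : ℝ) :
    HasDerivAt (fun y => ∑' k, c k * y ^ k) (∑' k : ℕ, (((k : ℝ) + 1) * c (k + 1)) * x ^ k) x := by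
  have hs : Summable fun k : ℕ => c k * (k * x ^ (k - 1)) := by
    rw [← summable_nat_add_iff 1]
    refine (summable_powerSeries (coeff_deriv_le hc) x).congr fun k => ?_
    simp
    ring
  have key := hasDerivAt_tsum_of_isPreconnected (𝕜 := ℝ) (F := ℝ)
    (u := fun k : ℕ => (1 / k.factorial : ℝ) * (k * (|x| + 1) ^ (k - 1)))
    (t := Metric.ball 0 (|x| + 1)) (g := fun k y => c k * y ^ k)
    (g' := fun k y => c k * (k * y ^ (k - 1))) (y₀ := 0) (y := x)
    ?_ Metric.isOpen_ball (convex_ball _ _).isPreconnected ?_ ?_ ?_ ?_ ?_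
  · have e : ∑' k : ℕ, (((k : ℝ) + 1) * c (k + 1)) * x ^ k =
        ∑' k : ℕ, c k * (k * x ^ (k - 1)) := by
      rw [hs.tsum_eq_zero_add]
      simp only [CharP.cast_eq_zero, zero_mul, mul_zero, zero_add, Nat.add_sub_cancel]
      refine tsum_congr fun k => ?_
      push_cast
      ring
    rw [e]
    exact key
  · rw [← summable_nat_add_iff 1]
    refine (Real.summable_pow_div_factorial (|x| + 1)).congr fun k => ?_
    rw [Nat.factorial_succ, Nat.add_sub_cancel]
    push_cast
    field_simp
  · intro k y _
    exact (hasDerivAt_pow k y).const_mul (c k)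
  · intro k y hy
    have hy' : |y| ≤ |x| + 1 := by
      have := Metric.mem_ball.1 hy
      rw [Real.dist_eq, sub_zero] at this
      exact this.le
    rw [Real.norm_eq_abs, abs_mul, abs_mul, abs_pow, Nat.abs_cast]
    gcongr
    exact hc k
  · simp [Metric.mem_ball]
    positivity
  · exact summable_powerSeries hc 0
  · simp [Metric.mem_ball]

/-- For `n ≥ 1` the series `φ_n` solves the initial value problem. -/
theorem isBesselSolution_besselPhi {n : ℕ} (hn : 1 ≤ n) : IsBesselSolution n (besselPhi n) := by
  have hn' : (1 : ℝ) ≤ n := by exact_mod_cast hn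
  let P : ℕ → ℝ := fun k => ∏ j ∈ Finset.Icc 1 k, (-2 * (j : ℝ)) * ((n : ℝ) - 2 + 2 * j)
  let c : ℕ → ℝ := fun k => 1 / P k
  have hP : ∀ k, P (k + 1) = P k * (-2 * ((k : ℝ) + 1) * (n + 2 * k)) := by
    intro k
    simp only [P]
    rw [Finset.prod_Icc_succ_top (by omega)]
    push_cast
    ring
  have hP0 : ∀ k, (k.factorial : ℝ) ≤ |P k| := by
    intro k
    induction k with
    | zero => simp [P]
    | succ k ih =>
      rw [hP, abs_mul, Nat.factorial_succ, mul_comm]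
      push_cast
      refine mul_le_mul ih ?_ (by positivity) (abs_nonneg _)
      rw [mul_assoc, neg_mul, abs_neg, abs_of_nonneg (by positivity)]
      nlinarith [Nat.cast_nonneg (α := ℝ) k]
  have hPne : ∀ k, P k ≠ 0 := fun k h => by
    have := hP0 k
    rw [h, abs_zero] at this
    exact absurd (Nat.cast_pos.2 k.factorial_pos) (not_lt.2 this)
  have hc : ∀ k, |c k| ≤ 1 / k.factorial := fun k => by
    simp only [c]
    rw [abs_div, abs_one]
    exact one_div_le_one_div_of_le (Nat.cast_pos.2 k.factorial_pos) (hP0 k)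
  have hrec : ∀ k : ℕ, 2 * ((k : ℝ) + 1) * (n + 2 * k) * c (k + 1) + c k = 0 := by
    intro k
    have h1 : (n : ℝ) + 2 * k ≠ 0 := by positivity
    have h2 := hPne k
    simp only [c, hP]
    field_simp
    ring
  let c1 : ℕ → ℝ := fun k => ((k : ℝ) + 1) * c (k + 1)
  let c2 : ℕ → ℝ := fun k => ((k : ℝ) + 1) * c1 (k + 1)
  have hc1 : ∀ k, |c1 k| ≤ 1 / k.factorial := coeff_deriv_le hc
  have hc2 : ∀ k, |c2 k| ≤ 1 / k.factorial := coeff_deriv_le hc1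
  let F : ℝ → ℝ := fun x => ∑' k, c k * x ^ k
  let F1 : ℝ → ℝ := fun x => ∑' k, c1 k * x ^ k
  let F2 : ℝ → ℝ := fun x => ∑' k, c2 k * x ^ k
  have hF : ∀ x, HasDerivAt F (F1 x) x := hasDerivAt_powerSeries hc
  have hF1 : ∀ x, HasDerivAt F1 (F2 x) x := hasDerivAt_powerSeries hc1
  have hF2 : ∀ x, HasDerivAt F2 _ x := hasDerivAt_powerSeries hc2
  have hφ : besselPhi n = fun r => F (r ^ 2) := by
    ext r
    refine tsum_congr fun k => ?_
    simp only [c, P, pow_mul]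
    ring
  have hsq : ∀ r : ℝ, HasDerivAt (fun r : ℝ => r ^ 2) (2 * r) r := fun r => by
    simpa using hasDerivAt_pow 2 r
  have hd1 : ∀ r, HasDerivAt (besselPhi n) (F1 (r ^ 2) * (2 * r)) r := fun r => by
    rw [hφ]
    exact (hF (r ^ 2)).comp r (hsq r)
  have hd1' : deriv (besselPhi n) = fun r => F1 (r ^ 2) * (2 * r) := funext fun r => (hd1 r).deriv
  have hd2 : ∀ r, HasDerivAt (deriv (besselPhi n))
      (F2 (r ^ 2) * (2 * r) * (2 * r) + F1 (r ^ 2) * 2) r := fun r => by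
    rw [hd1']
    have h2 : HasDerivAt (fun r : ℝ => 2 * r) 2 r := by simpa using (hasDerivAt_id r).const_mul 2
    exact ((hF1 (r ^ 2)).comp r (hsq r)).mul h2
  have hd2' : deriv (deriv (besselPhi n)) =
      fun r => F2 (r ^ 2) * (2 * r) * (2 * r) + F1 (r ^ 2) * 2 := funext fun r => (hd2 r).deriv
  have hcF1 : Continuous F1 := continuous_iff_continuousAt.2 fun x => (hF1 x).continuousAt
  have hcF2 : Continuous F2 := continuous_iff_continuousAt.2 fun x => (hF2 x).continuousAt
  have hODE : ∀ x, 4 * (x * F2 x) + 2 * n * F1 x + F x = 0 := by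
    intro x
    have s0 := summable_powerSeries hc x
    have s1 := summable_powerSeries hc1 x
    have s2 := summable_powerSeries hc2 x
    have e2 : HasSum (fun k : ℕ => ((k : ℝ) * c1 k) * x ^ k) (x * F2 x) := by
      rw [← hasSum_nat_add_iff' 1]
      simp only [Finset.range_one, Finset.sum_singleton, CharP.cast_eq_zero, zero_mul, sub_zero]
      have e3 : (fun k : ℕ => ((k + 1 : ℕ) : ℝ) * c1 (k + 1) * x ^ (k + 1)) =
          fun k => x * (c2 k * x ^ k) := by
        ext k
        simp only [c2]
        push_cast
        ring
      rw [e3]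
      exact s2.hasSum.mul_left x
    have e := ((e2.mul_left 4).add (s1.hasSum.mul_left (2 * (n : ℝ)))).add s0.hasSum
    refine e.unique ?_
    convert hasSum_zero using 1
    ext k
    have := hrec k
    simp only [c1]
    linear_combination x ^ k * this
  refine ⟨?_, ?_, ?_, ?_⟩
  · rw [show (2 : WithTop ℕ∞) = 1 + 1 by norm_num, contDiff_succ_iff_deriv]
    refine ⟨fun r => (hd1 r).differentiableAt, by simp, ?_⟩
    rw [contDiff_one_iff_deriv]
    refine ⟨fun r => (hd2 r).differentiableAt, ?_⟩
    rw [hd2']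
    fun_prop
  · rw [besselPhi, tsum_eq_single 0]
    · simp
    · intro k hk
      simp [hk]
  · rw [hd1']
    simp
  · intro r hr
    rw [hd2', hd1', hφ]
    have := hODE (r ^ 2)
    field_simp
    linear_combination this

/-- For `n ≥ 1` the function `φ_n` is the unique solution of the initial value problem. -/
theorem IsBesselSolution.eq_besselPhi {n : ℕ} (hn : 1 ≤ n) {φ : ℝ → ℝ}
    (hφ : IsBesselSolution n φ) : φ = besselPhi n := by
  have hn' : (1 : ℝ) ≤ n := by exact_mod_cast hn
  have hψ := isBesselSolution_besselPhi hn
  set ψ := besselPhi n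
  have hdiff : ∀ {f : ℝ → ℝ}, IsBesselSolution n f →
      (∀ r, HasDerivAt f (deriv f r) r) ∧ ∀ r, HasDerivAt (deriv f) (deriv (deriv f) r) r := by
    intro f hf
    have h := hf.contDiff
    rw [show (2 : WithTop ℕ∞) = 1 + 1 by norm_num, contDiff_succ_iff_deriv] at h
    exact ⟨fun r => (h.1 r).hasDerivAt,
      fun r => (h.2.2.differentiable (by simp) r).hasDerivAt⟩
  obtain ⟨a1, a2⟩ := hdiff hφ
  obtain ⟨b1, b2⟩ := hdiff hψ
  let E : ℝ → ℝ := fun r => (φ r - ψ r) ^ 2 + (deriv φ r - deriv ψ r) ^ 2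
  have hE : ∀ r, HasDerivAt E (2 * (φ r - ψ r) * (deriv φ r - deriv ψ r) +
      2 * (deriv φ r - deriv ψ r) * (deriv (deriv φ) r - deriv (deriv ψ) r)) r := fun r => by
    have h := (((a1 r).fun_sub (b1 r)).fun_pow 2).fun_add (((a2 r).fun_sub (b2 r)).fun_pow 2)
    have e : 2 * (φ r - ψ r) * (deriv φ r - deriv ψ r) +
        2 * (deriv φ r - deriv ψ r) * (deriv (deriv φ) r - deriv (deriv ψ) r) =
        ((2 : ℕ) : ℝ) * (φ r - ψ r) ^ (2 - 1) * (deriv φ r - deriv ψ r) +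
        ((2 : ℕ) : ℝ) * (deriv φ r - deriv ψ r) ^ (2 - 1) *
          (deriv (deriv φ) r - deriv (deriv ψ) r) := by
      norm_num
    rw [e]
    exact h
  have hE' : ∀ r, r ≠ 0 →
      deriv E r = -(2 * (n - 1) * (deriv φ r - deriv ψ r) ^ 2) / r := fun r hr => by
    rw [(hE r).deriv]
    have h1 : deriv (deriv φ) r = -((n - 1) * (deriv φ r / r) + φ r) := by
      linear_combination hφ.ode r hr
    have h2 : deriv (deriv ψ) r = -((n - 1) * (deriv ψ r / r) + ψ r) := by
      linear_combination hψ.ode r hr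
    rw [h1, h2]
    field_simp
    ring
  have hcont : Continuous E := continuous_iff_continuousAt.2 fun r => (hE r).continuousAt
  have hE0 : E 0 = 0 := by simp [E, hφ.map_zero, hψ.map_zero, hφ.deriv_zero, hψ.deriv_zero]
  have hnum : ∀ r, 0 ≤ 2 * ((n : ℝ) - 1) * (deriv φ r - deriv ψ r) ^ 2 := fun r =>
    mul_nonneg (by linarith) (sq_nonneg _)
  have hle : ∀ r, E r ≤ 0 := by
    intro r
    rcases le_total 0 r with hr | hr
    · have := antitoneOn_of_deriv_nonpos (convex_Ici 0) hcont.continuousOn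
        (fun x _ => (hE x).differentiableAt.differentiableWithinAt) (fun x hx => by
          rw [interior_Ici] at hx
          rw [hE' x hx.ne']
          exact div_nonpos_of_nonpos_of_nonneg (neg_nonpos.2 (hnum x)) hx.le)
        (Set.mem_Ici.2 le_rfl) (Set.mem_Ici.2 hr) hr
      rwa [hE0] at this
    · have := monotoneOn_of_deriv_nonneg (convex_Iic 0) hcont.continuousOn
        (fun x _ => (hE x).differentiableAt.differentiableWithinAt) (fun x hx => by
          rw [interior_Iic] at hx
          rw [hE' x hx.ne]
          exact div_nonneg_of_nonpos (neg_nonpos.2 (hnum x)) hx.le)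
        (Set.mem_Iic.2 hr) (Set.mem_Iic.2 le_rfl) hr
      rwa [hE0] at this
  ext r
  have h := hle r
  simp only [E] at h
  have : (φ r - ψ r) ^ 2 = 0 := by nlinarith [sq_nonneg (φ r - ψ r), sq_nonneg (deriv φ r - deriv ψ r)]
  exact sub_eq_zero.1 (pow_eq_zero_iff (by norm_num) |>.1 this)

/-- `T` is the deformed exterior derivative `d_t = t φ_{q+2}(tD) d`, as a bounded operator on the
Hilbert space of square integrable forms on `ℝ^q`: it is the bounded extension of the operator
`ω ↦ t φ_{q+2}(tD) dω` from the dense domain of rapidly decreasing smooth forms `ω`. -/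
def IsDeformedExtD {q : ℕ} (t : ℝ) (T : FormL2 q →L[ℂ] FormL2 q) : Prop :=
  ∃ Φ : FormL2 q →L[ℂ] FormL2 q, IsFunctionOfDirac (fun r => besselPhi (q + 2) (t * r)) Φ ∧
    ∀ ω : 𝓢(Space q, FormFiber q), T (ω.toLp 2) = (t : ℂ) • Φ ((extD ω).toLp 2)

/-- The form `u` is the image of `f` under the extension of the bounded operator `T` to forms `f`
which need not be square integrable, in the sense of distributions (currents): for each smooth
compactly supported test form `ψ`, one has `⟨T* ψ, f⟩ = ⟨ψ, u⟩`, where the integral on the left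
converges absolutely. -/
def IsDistributionalImage {q : ℕ} (T : FormL2 q →L[ℂ] FormL2 q) (f u : Space q → FormFiber q) :
    Prop :=
  ∀ ψ : 𝓢(Space q, FormFiber q), HasCompactSupport ψ →
    Integrable (fun x => inner ℂ (ContinuousLinearMap.adjoint T (ψ.toLp 2) x) (f x)) ∧
    ∫ x, inner ℂ (ContinuousLinearMap.adjoint T (ψ.toLp 2) x) (f x) = ∫ x, inner ℂ (ψ x) (u x)

/-! ### Alternating forms, wave fronts and flux -/

/-- The coordinates of an alternating `k`-form in the basis `dx_I`: the coefficient of `dx_I`, where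
`I = {i₁ < … < iₖ}`, is the value of the form on `(e_{i₁}, …, e_{iₖ})`. -/
noncomputable def formCoords {q k : ℕ} :
    (Space q [⋀^Fin k]→L[ℝ] ℂ) →L[ℝ] FormFiber q :=
  (PiLp.continuousLinearEquiv 2 ℝ fun _ : Finset (Fin q) => ℂ).symm.toContinuousLinearMap.comp
    (ContinuousLinearMap.pi fun I : Finset (Fin q) =>
      if h : I.card = k then
        ContinuousAlternatingMap.apply ℝ (Space q) ℂ fun j => stdVec (I.orderEmbOfFin h j)
      else 0)

theorem formCoords_apply {q k : ℕ} (α : Space q [⋀^Fin k]→L[ℝ] ℂ) (I : Finset (Fin q)) :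
    formCoords α I =
      if h : I.card = k then α fun j => stdVec (I.orderEmbOfFin h j) else 0 := by
  change (ContinuousLinearMap.pi fun I : Finset (Fin q) =>
      if h : I.card = k then
        ContinuousAlternatingMap.apply ℝ (Space q) ℂ fun j => stdVec (I.orderEmbOfFin h j)
      else 0) α I = _
  rw [ContinuousLinearMap.pi_apply]
  by_cases h : I.card = k
  · rw [dif_pos h, dif_pos h]
    rfl
  · rw [dif_neg h, dif_neg h]
    rfl

/-- In these coordinates the exterior derivative is `∑ᵢ dx_i ∧ ∂ᵢ`. -/
theorem formCoords_extDeriv {q k : ℕ} (f : Space q → Space q [⋀^Fin k]→L[ℝ] ℂ) (x : Space q)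
    (hf : DifferentiableAt ℝ f x) :
    formCoords (extDeriv f x) =
      ∑ i, wedge i (fderiv ℝ (fun y => formCoords (f y)) x (stdVec i)) := by
  have hfd : ∀ v, fderiv ℝ (fun y => formCoords (f y)) x v = formCoords (fderiv ℝ f x v) := by
    intro v
    have h := (formCoords (q := q) (k := k)).hasFDerivAt.comp x hf.hasFDerivAt
    have h' : fderiv ℝ (fun y => formCoords (f y)) x = _ := h.fderiv
    rw [h']
    rfl
  have hw : ∀ (i : Fin q) (η : FormFiber q) (I : Finset (Fin q)), wedge i η I =
      if i ∈ I then (-1 : ℂ) ^ (I.filter (· < i)).card * η (I.erase i) else 0 :=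
    fun _ _ _ => rfl
  ext I
  simp only [hfd, WithLp.ofLp_sum, Finset.sum_apply, hw]
  rw [← Finset.sum_filter, Finset.filter_mem_eq_inter, Finset.univ_inter]
  rw [formCoords_apply]
  split_ifs with hI
  · rw [extDeriv, ContinuousAlternatingMap.alternatizeUncurryFin_apply]
    refine Finset.sum_bij (fun j _ => I.orderEmbOfFin hI j) ?_ ?_ ?_ ?_
    · exact fun j _ => Finset.orderEmbOfFin_mem I hI j
    · exact fun a _ b _ h => (I.orderEmbOfFin hI).injective h
    · intro i hi
      have : i ∈ Set.range (I.orderEmbOfFin hI) := by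
        rw [Finset.range_orderEmbOfFin]
        exact hi
      obtain ⟨j, rfl⟩ := this
      exact ⟨j, Finset.mem_univ _, rfl⟩
    · intro j _
      have hmem := Finset.orderEmbOfFin_mem I hI j
      have hcard : (I.erase (I.orderEmbOfFin hI j)).card = k := by
        rw [Finset.card_erase_of_mem hmem, hI, Nat.add_sub_cancel]
      have hfilt : (I.filter (· < I.orderEmbOfFin hI j)).card = j := by
        have : I.filter (· < I.orderEmbOfFin hI j) =
            (Finset.Iio j).map (I.orderEmbOfFin hI).toEmbedding := by
          ext i
          simp only [Finset.mem_filter, Finset.mem_map, Finset.mem_Iio, RelEmbedding.coe_toEmbedding]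
          constructor
          · rintro ⟨hi, hlt⟩
            have : i ∈ Set.range (I.orderEmbOfFin hI) := by
              rw [Finset.range_orderEmbOfFin]
              exact hi
            obtain ⟨l, rfl⟩ := this
            exact ⟨l, (I.orderEmbOfFin hI).lt_iff_lt.1 hlt, rfl⟩
          · rintro ⟨l, hl, rfl⟩
            exact ⟨Finset.orderEmbOfFin_mem I hI l, (I.orderEmbOfFin hI).lt_iff_lt.2 hl⟩
        rw [this, Finset.card_map, Fin.card_Iio]
      have hu : (fun l : Fin k => I.orderEmbOfFin hI (j.succAbove l)) =
          (I.erase (I.orderEmbOfFin hI j)).orderEmbOfFin hcard := by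
        refine Finset.orderEmbOfFin_unique hcard (fun l => ?_) ?_
        · rw [Finset.mem_erase]
          exact ⟨fun h => Fin.succAbove_ne j l ((I.orderEmbOfFin hI).injective h),
            Finset.orderEmbOfFin_mem I hI _⟩
        · exact (I.orderEmbOfFin hI).strictMono.comp (Fin.strictMono_succAbove j)
      rw [hfilt, formCoords_apply, dif_pos hcard, ← hu]
      rw [zsmul_eq_mul]
      push_cast
      rfl
  · refine (Finset.sum_eq_zero fun i hi => ?_).symm
    rw [formCoords_apply, dif_neg, mul_zero]
    rw [Finset.card_erase_of_mem hi]
    have : 0 < I.card := Finset.card_pos.2 ⟨i, hi⟩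
    omega

/-- The volume form `c dx_1 ∧ … ∧ dx_q`. -/
noncomputable def volForm {q : ℕ} (c : ℂ) : FormFiber q := EuclideanSpace.single Finset.univ c

/-- The surface measure on the wave front `W_t(p) = {p + t v : |v| = 1}` in `ℝ^{n+1}`: the image of
the surface measure on the unit sphere, scaled by `tⁿ`. -/
noncomputable def waveFrontMeasure {n : ℕ} (t : ℝ) (p : Space (n + 1)) : Measure (Space (n + 1)) :=
  ENNReal.ofReal (t ^ n) •
    Measure.map (fun v : Metric.sphere (0 : Space (n + 1)) 1 => p + t • (v : Space (n + 1)))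
      (Measure.toSphere volume)

/-- The density, with respect to surface measure, of the restriction of the `n`-form `α` on
`ℝ^{n+1}` to an oriented hypersurface with unit normal `ν`: the coefficient of the volume form in
`ν♭ ∧ α`. -/
noncomputable def fluxDensity {n : ℕ} (ν : Space (n + 1))
    (α : Space (n + 1) [⋀^Fin n]→L[ℝ] ℂ) : ℂ :=
  ContinuousAlternatingMap.alternatizeUncurryFin ((innerSL ℝ ν).smulRight α) stdVec

/-- The flux density is the value of the form on each positively oriented orthonormal basis of the
tangent space (outward normal first). -/
theorem fluxDensity_eq {n : ℕ} (b : OrthonormalBasis (Fin (n + 1)) ℝ (Space (n + 1)))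
    (hb : b.toBasis.orientation =
      (EuclideanSpace.basisFun (Fin (n + 1)) ℝ).toBasis.orientation)
    (α : Space (n + 1) [⋀^Fin n]→L[ℝ] ℂ) :
    fluxDensity (b 0) α = α fun j => b j.succ := by
  have key : ∀ g : Space (n + 1) [⋀^Fin (n + 1)]→ₗ[ℝ] ℝ, g stdVec = g b := by
    intro g
    rw [AlternatingMap.eq_smul_basis_det b.toBasis g]
    have h := b.det_to_matrix_orthonormalBasis_of_same_orientation
      (EuclideanSpace.basisFun (Fin (n + 1)) ℝ) hb
    have h2 := b.toBasis.det_self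
    have e : (stdVec : Fin (n + 1) → Space (n + 1)) =
        EuclideanSpace.basisFun (Fin (n + 1)) ℝ := by
      ext i
      simp
    rw [OrthonormalBasis.coe_toBasis] at h2
    rw [AlternatingMap.smul_apply, AlternatingMap.smul_apply, e, h, h2]
  let A := ContinuousAlternatingMap.alternatizeUncurryFin ((innerSL ℝ (b 0)).smulRight α)
  have hA : A stdVec = A b := by
    apply Complex.ext
    · exact key (Complex.reLm.compAlternatingMap A.toAlternatingMap)
    · exact key (Complex.imLm.compAlternatingMap A.toAlternatingMap)
  change A stdVec = _
  rw [hA, ContinuousAlternatingMap.alternatizeUncurryFin_apply, Finset.sum_eq_single 0]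
  · simp
    rfl
  · intro i _ hi
    have : inner ℝ (b 0) (b i) = 0 := b.orthonormal.2 hi.symm
    simp [this]
  · simp

/-- The flux `∫_{W_t(p)} f` of an `n`-form `f` on `ℝ^{n+1}` through the wave front `W_t(p)`, oriented
by the outward unit normal. -/
noncomputable def flux {n : ℕ} (f : Space (n + 1) → Space (n + 1) [⋀^Fin n]→L[ℝ] ℂ) (t : ℝ)
    (p : Space (n + 1)) : ℂ :=
  ∫ x, fluxDensity (t⁻¹ • (x - p)) (f x) ∂(waveFrontMeasure t p)

/-- The average flux `|W_t(p)|⁻¹ ∫_{W_t(p)} f`. -/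
noncomputable def averageFlux {n : ℕ} (f : Space (n + 1) → Space (n + 1) [⋀^Fin n]→L[ℝ] ℂ) (t : ℝ)
    (p : Space (n + 1)) : ℂ :=
  ((waveFrontMeasure t p).real Set.univ : ℂ)⁻¹ * flux f t p

/-! ### Derivatives of the Bessel functions -/

/-! Write q = n + 1. In the frequency domain both sides of the identity are the same Fourier
multiplier.

The Clifford relations make the square of the symbol of D the scalar (2π|ξ|)²
(`diracSymbol_mul_self`). Since φ_{q+2} is even, φ_{q+2}(tD) acts as the scalar φ_{q+2}(2πt|ξ|)
(`cfc_diracSymbol`), and d_t has the symbol 2πi t φ_{q+2}(2πt|ξ|) ξ♭∧.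

On the geometric side, the Fourier transform of the normalized surface measure σ of the unit sphere
is radial and solves the Helmholtz equation, hence the Bessel equation; by uniqueness it is φ_q(|ξ|)
(`integral_sphere_cos`). Because φ_q'(r) = -(r/q) φ_{q+2}(r), differentiating in ξ shows that the
vector measure v dσ(v) has the transform (i/q) φ_{q+2}(|ξ|) ξ (`integral_sphere_smul_exp`). At the
frequency 2πtξ, q times this is the symbol of d_t (`deformedSymbol_apply`). So d_t is bounded, and
on rapidly decreasing forms it is the operator ω ↦ q ⨍ v♭ ∧ ω(p + tv) dσ(v).

For a (q-1)-form, v♭ ∧ f is the flux density times the volume form (`wedgeVec_formCoords`), so this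
average is u. To reach arbitrary continuous f, pass to the adjoint: it sends a compactly supported
test form to its transposed average, again continuous with compact support
(`IsFourierMultiplier.adjoint_toLp`), and Fubini gives the weak identity
(`integral_inner_sphereCoaverage`). For square integrable f, testing then identifies d_t f with u
almost everywhere. -/

/-- The power series `Φ_n` with `φ_n(r) = Φ_n(r²)`. -/
noncomputable def besselSeries (n : ℕ) (x : ℝ) : ℝ :=
  ∑' k : ℕ, (1 / ∏ j ∈ Finset.Icc 1 k, (-2 * (j : ℝ)) * ((n : ℝ) - 2 + 2 * j)) * x ^ k

theorem besselPhi_eq_besselSeries (n : ℕ) (r : ℝ) : besselPhi n r = besselSeries n (r ^ 2) := by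
  refine tsum_congr fun k => ?_
  rw [pow_mul]
  ring

theorem abs_besselCoeff_le {n : ℕ} (hn : 1 ≤ n) (k : ℕ) :
    |1 / ∏ j ∈ Finset.Icc 1 k, (-2 * (j : ℝ)) * ((n : ℝ) - 2 + 2 * j)| ≤ 1 / k.factorial := by
  have hn' : (1 : ℝ) ≤ n := by exact_mod_cast hn
  rw [abs_div, abs_one]
  refine one_div_le_one_div_of_le (Nat.cast_pos.2 k.factorial_pos) ?_
  induction k with
  | zero => simp
  | succ k ih =>
    rw [Finset.prod_Icc_succ_top (by omega), abs_mul, Nat.factorial_succ, mul_comm]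
    push_cast
    refine mul_le_mul ih ?_ (by positivity) (abs_nonneg _)
    rw [show -2 * ((k : ℝ) + 1) * ((n : ℝ) - 2 + 2 * (k + 1)) = -(2 * (k + 1) * (n + 2 * k)) by ring,
      abs_neg, abs_of_nonneg (by positivity)]
    -- The new factor 2(k + 1)(n + 2k) is at least k + 1 because n ≥ 1.
    nlinarith [Nat.cast_nonneg (α := ℝ) k]

/-- This is φ_n' = -(r/n) φ_{n+2} in the variable x = r², and the source of the index q + 2.
Shifting the index in the product of n - 2 + 2j replaces n by n + 2 and splits off the factor n; the
factor k + 1 cancels against differentiation. -/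
theorem hasDerivAt_besselSeries {n : ℕ} (hn : 1 ≤ n) (x : ℝ) :
    HasDerivAt (besselSeries n) (-(1 / (2 * n)) * besselSeries (n + 2) x) x := by
  have hn' : (n : ℝ) ≠ 0 := by positivity
  convert! hasDerivAt_powerSeries (abs_besselCoeff_le hn) x using 1
  rw [besselSeries, ← tsum_mul_left]
  refine tsum_congr fun k => ?_
  rw [← mul_assoc]
  congr 1
  have key : ∀ k : ℕ, ∏ j ∈ Finset.Icc 1 (k + 1), (-2 * (j : ℝ)) * ((n : ℝ) - 2 + 2 * j) =
      -2 * (k + 1) * n * ∏ j ∈ Finset.Icc 1 k, (-2 * (j : ℝ)) * (((n + 2 : ℕ) : ℝ) - 2 + 2 * j) := by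
    intro k
    induction k with
    | zero => simp
    | succ k ih =>
      rw [Finset.prod_Icc_succ_top (by omega), ih, Finset.prod_Icc_succ_top (by omega)]
      push_cast
      ring
  have hk : (k : ℝ) + 1 ≠ 0 := by positivity
  rw [key]
  simp only [one_div, mul_inv]
  field_simp

theorem continuous_besselPhi {n : ℕ} (hn : 1 ≤ n) : Continuous (besselPhi n) :=
  (isBesselSolution_besselPhi hn).contDiff.continuous

/-! ### The normalized surface measure on the unit sphere -/

/-- The unit sphere of `ℝ^{n+1}`. -/
abbrev USphere (n : ℕ) := Metric.sphere (0 : Space (n + 1)) 1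

/-- The normalized surface measure on the unit sphere. -/
noncomputable def sphereProb (n : ℕ) : Measure (USphere n) :=
  (Measure.toSphere (volume : Measure (Space (n + 1))) Set.univ)⁻¹ • Measure.toSphere volume

instance (n : ℕ) : NeZero (Measure.toSphere (volume : Measure (Space (n + 1)))) :=
  ⟨Measure.toSphere_ne_zero _⟩

instance (n : ℕ) : IsProbabilityMeasure (sphereProb n) := isProbabilityMeasureSMul

theorem continuous_integral_of_compactSpace {X Y E : Type*} [TopologicalSpace X]
    [FirstCountableTopology X] [LocallyCompactSpace X] [TopologicalSpace Y] [CompactSpace Y]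
    [MeasurableSpace Y] [OpensMeasurableSpace Y] [SecondCountableTopology Y]
    [NormedAddCommGroup E] [NormedSpace ℝ E] (μ : Measure Y) [IsFiniteMeasure μ] {f : X → Y → E}
    (hf : Continuous (Function.uncurry f)) : Continuous fun x => ∫ y, f x y ∂μ := by
  have := continuous_parametric_integral_of_continuous (μ := μ) hf isCompact_univ
  simpa using this

theorem integrable_of_compactSpace {Y E : Type*} [TopologicalSpace Y] [CompactSpace Y]
    [MeasurableSpace Y] [OpensMeasurableSpace Y] [NormedAddCommGroup E]
    [SecondCountableTopologyEither Y E] (μ : Measure Y) [IsFiniteMeasure μ] {f : Y → E}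
    (hf : Continuous f) : Integrable f μ :=
  hf.integrable_of_hasCompactSupport (HasCompactSupport.of_compactSpace f)

theorem hasDerivAt_integral_of_compactSpace {Y : Type*} [TopologicalSpace Y] [CompactSpace Y]
    [MeasurableSpace Y] [OpensMeasurableSpace Y] (μ : Measure Y) [IsFiniteMeasure μ]
    {f f' : ℝ → Y → ℝ} (hf : ∀ s, Continuous (f s)) (hf' : Continuous (Function.uncurry f'))
    (h : ∀ s y, HasDerivAt (fun s => f s y) (f' s y) s) (s : ℝ) :
    HasDerivAt (fun s => ∫ y, f s y ∂μ) (∫ y, f' s y ∂μ) s := by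
  obtain ⟨C, hC⟩ := ((isCompact_closedBall s 1).prod (isCompact_univ (X := Y))).exists_bound_of_continuousOn
    hf'.continuousOn
  refine (hasDerivAt_integral_of_dominated_loc_of_deriv_le (bound := fun _ => C)
    (Metric.closedBall_mem_nhds s one_pos) (.of_forall fun s => (hf s).aestronglyMeasurable)
    (integrable_of_compactSpace μ (hf s)) ?_ (.of_forall fun y s hs => ?_) (integrable_const C)
    (.of_forall fun y s _ => h s y)).2
  · exact (hf'.comp (Continuous.prodMk_right s)).aestronglyMeasurable
  · exact hC (s, y) ⟨hs, Set.mem_univ _⟩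

-- The surface measure of a set is a multiple of the volume of the cone over it. A linear isometry
-- maps cones to cones and preserves volume.
open scoped Pointwise in
theorem integral_sphereProb_comp_isometry {n : ℕ} {E : Type*} [NormedAddCommGroup E]
    [NormedSpace ℝ E] (R : Space (n + 1) ≃ₗᵢ[ℝ] Space (n + 1)) (g : Space (n + 1) → E) :
    ∫ v : USphere n, g (R v) ∂(sphereProb n) = ∫ v : USphere n, g v ∂(sphereProb n) := by
  let e : USphere n ≃ₜ USphere n :=
    { toFun := fun v => ⟨R v, by simp⟩
      invFun := fun v => ⟨R.symm v, by simp⟩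
      left_inv := fun v => by simp
      right_inv := fun v => by simp
      continuous_toFun := by fun_prop
      continuous_invFun := by fun_prop }
  have he : MeasurePreserving e (Measure.toSphere (volume : Measure (Space (n + 1))))
      (Measure.toSphere volume) := by
    refine ⟨e.continuous.measurable, Measure.ext fun s hs => ?_⟩
    rw [Measure.map_apply e.continuous.measurable hs, Measure.toSphere_apply' _ hs,
      Measure.toSphere_apply' _ (e.continuous.measurable hs)]
    congr 1
    have h1 : Set.Ioo (0 : ℝ) 1 • (Subtype.val '' (e ⁻¹' s)) =
        R ⁻¹' (Set.Ioo (0 : ℝ) 1 • (Subtype.val '' s)) := by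
      ext x
      simp only [Set.mem_preimage, Set.mem_smul, Set.mem_image]
      constructor
      · rintro ⟨r, hr, _, ⟨v, hv, rfl⟩, rfl⟩
        exact ⟨r, hr, _, ⟨e v, hv, rfl⟩, by simp [e]⟩
      · rintro ⟨r, hr, _, ⟨v, hv, rfl⟩, hx⟩
        refine ⟨r, hr, _, ⟨e.symm v, by simpa using hv, rfl⟩, ?_⟩
        apply R.injective
        rw [← hx, map_smul]
        congr 1
        exact R.apply_symm_apply _
    rw [h1]
    exact R.measurePreserving.measure_preimage_equiv (f := R.toHomeomorph.toMeasurableEquiv) _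
  rw [sphereProb, integral_smul_measure, integral_smul_measure]
  congr 1
  exact he.integral_comp e.measurableEmbedding (fun v => g v)

/-! ### The Fourier transform of the unit sphere -/

/-- The Fourier transform of the sphere depends on the norm only. -/
theorem integral_sphere_cos_congr {n : ℕ} {ξ η : Space (n + 1)} (h : ‖ξ‖ = ‖η‖) :
    ∫ v : USphere n, Real.cos (inner ℝ ξ v) ∂(sphereProb n) =
      ∫ v : USphere n, Real.cos (inner ℝ η v) ∂(sphereProb n) := by
  -- For vectors of equal norm, the reflection in the hyperplane orthogonal to ξ - η carries ξ to η.
  let R := (Submodule.span ℝ {ξ - η})ᗮ.reflection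
  have hR : R ξ = η := Submodule.reflection_sub h
  rw [← integral_sphereProb_comp_isometry R fun v => Real.cos (inner ℝ η v), ← hR]
  simp only [LinearIsometryEquiv.inner_map_map]

theorem integral_sphere_odd {n : ℕ} {g : Space (n + 1) → ℝ} (hg : ∀ v, g (-v) = -g v) :
    ∫ v : USphere n, g v ∂(sphereProb n) = 0 := by
  have h := integral_sphereProb_comp_isometry (LinearIsometryEquiv.neg ℝ) g
  simp only [LinearIsometryEquiv.coe_neg, hg, integral_neg] at h
  linarith

theorem hasDerivAt_integral_sphere_cos {n : ℕ} (ξ η : Space (n + 1)) (s : ℝ) :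
    HasDerivAt (fun s : ℝ => ∫ v : USphere n, Real.cos (inner ℝ (ξ + s • η) v) ∂(sphereProb n))
      (-∫ v : USphere n, inner ℝ η (v : Space (n + 1)) *
        Real.sin (inner ℝ (ξ + s • η) v) ∂(sphereProb n)) s := by
  rw [← integral_neg]
  refine hasDerivAt_integral_of_compactSpace _ (f' := fun s (v : USphere n) =>
    -(inner ℝ η (v : Space (n + 1)) * Real.sin (inner ℝ (ξ + s • η) v)))
    (fun s => by fun_prop) (by fun_prop) (fun s v => ?_) s
  simp only [inner_add_left, real_inner_smul_left]
  have h := ((hasDerivAt_id s).mul_const (inner ℝ η (v : Space (n + 1)))).const_add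
    (inner ℝ ξ (v : Space (n + 1)))
  convert! h.cos using 1
  simp
  ring

theorem hasDerivAt_integral_sphere_mul_sin {n : ℕ} (ξ η : Space (n + 1)) (s : ℝ) :
    HasDerivAt (fun s : ℝ => ∫ v : USphere n, inner ℝ η (v : Space (n + 1)) *
        Real.sin (inner ℝ (ξ + s • η) v) ∂(sphereProb n))
      (∫ v : USphere n, inner ℝ η (v : Space (n + 1)) ^ 2 *
        Real.cos (inner ℝ (ξ + s • η) v) ∂(sphereProb n)) s := by
  refine hasDerivAt_integral_of_compactSpace _ (f' := fun s (v : USphere n) =>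
    inner ℝ η (v : Space (n + 1)) ^ 2 * Real.cos (inner ℝ (ξ + s • η) v))
    (fun s => by fun_prop) (by fun_prop) (fun s v => ?_) s
  simp only [inner_add_left, real_inner_smul_left]
  have h := ((hasDerivAt_id s).mul_const (inner ℝ η (v : Space (n + 1)))).const_add
    (inner ℝ ξ (v : Space (n + 1)))
  convert! h.sin.const_mul (inner ℝ η (v : Space (n + 1))) using 1
  simp
  ring

theorem norm_stdVec {q : ℕ} (i : Fin q) : ‖stdVec i‖ = 1 := by simp [stdVec]

theorem inner_stdVec_left {q : ℕ} (i : Fin q) (x : Space q) : inner ℝ (stdVec i) x = x i := by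
  simp [EuclideanSpace.inner_single_left]

/-- A radial function has orthogonal second derivatives equal to its radial derivative over `r`. -/
theorem integral_sphere_sq_mul_cos {n : ℕ} {j : Fin (n + 1)} (hj : j ≠ 0) {r : ℝ} (hr : r ≠ 0) :
    ∫ v : USphere n, inner ℝ (stdVec j) (v : Space (n + 1)) ^ 2 *
        Real.cos (inner ℝ (r • stdVec 0) (v : Space (n + 1))) ∂(sphereProb n) =
      (∫ v : USphere n, inner ℝ (stdVec 0) (v : Space (n + 1)) *
        Real.sin (inner ℝ (r • stdVec 0) (v : Space (n + 1))) ∂(sphereProb n)) / r := by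
  set B : ℝ → ℝ := fun r => ∫ v : USphere n, inner ℝ (stdVec 0) (v : Space (n + 1)) *
        Real.sin (inner ℝ (r • stdVec 0) (v : Space (n + 1))) ∂(sphereProb n) with hB
  let A : ℝ → ℝ := fun r => ∫ v : USphere n, Real.cos (inner ℝ (r • stdVec 0) (v : Space (n + 1))) ∂(sphereProb n)
  have hA : ∀ s, HasDerivAt A (-B s) s := fun s => by
    simpa using hasDerivAt_integral_sphere_cos (0 : Space (n + 1)) (stdVec 0) s
  have hBc : Continuous B := by
    refine continuous_integral_of_compactSpace _ ?_
    fun_prop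
  -- The norm of r e₀ + s e_j. By radial symmetry the transform along this transverse line is A ∘ ρ.
  -- The plan is to differentiate it twice at s = 0, once under the integral and once by the chain
  -- rule.
  let ρ : ℝ → ℝ := fun s => Real.sqrt (r ^ 2 + s ^ 2)
  have hpos : ∀ s, 0 < r ^ 2 + s ^ 2 := fun s => by positivity
  have hρ : ∀ s, HasDerivAt ρ (s / ρ s) s := fun s => by
    have h := ((hasDerivAt_pow 2 s).const_add (r ^ 2)).sqrt (hpos s).ne'
    convert! h using 1
    have : ρ s ≠ 0 := (Real.sqrt_pos.2 (hpos s)).ne'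
    simp only [ρ] at this ⊢
    field_simp
    norm_num [mul_comm]
  have hrad : ∀ s, A (ρ s) =
      ∫ v : USphere n, Real.cos (inner ℝ (r • stdVec 0 + s • stdVec j) (v : Space (n + 1))) ∂(sphereProb n) := by
    intro s
    refine integral_sphere_cos_congr ?_
    rw [norm_smul, norm_stdVec, mul_one, Real.norm_eq_abs, abs_of_nonneg (Real.sqrt_nonneg _),
      ← Real.sqrt_sq (norm_nonneg _)]
    congr 1
    rw [← real_inner_self_eq_norm_sq]
    simp only [inner_add_left, inner_add_right, real_inner_smul_left, real_inner_smul_right,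
      inner_stdVec_left]
    simp [stdVec, hj, hj.symm]
    ring
  have h1 : ∀ s, ∫ v : USphere n, inner ℝ (stdVec j) (v : Space (n + 1)) *
        Real.sin (inner ℝ (r • stdVec 0 + s • stdVec j) (v : Space (n + 1))) ∂(sphereProb n) =
      s * (B (ρ s) / ρ s) := by
    intro s
    have h2 := (hA (ρ s)).comp s (hρ s)
    have h3 := hasDerivAt_integral_sphere_cos (r • stdVec 0) (stdVec j) s
    have h4 := h2.unique (h3.congr_of_eventuallyEq (.of_forall hrad))
    linear_combination h4
  have h2 := (hasDerivAt_integral_sphere_mul_sin (r • stdVec 0) (stdVec j) 0).congr_of_eventuallyEq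
    (.of_forall fun s => (h1 s).symm)
  have hρ0 : ρ 0 ≠ 0 := (Real.sqrt_pos.2 (hpos 0)).ne'
  -- The factor s vanishes at 0, so continuity of the other factor suffices.
  have h3 : HasDerivAt (fun s => s * (B (ρ s) / ρ s)) (B (ρ 0) / ρ 0) 0 := by
    rw [hasDerivAt_iff_tendsto_slope]
    have hc : ContinuousAt (fun s => B (ρ s) / ρ s) 0 :=
      (hBc.continuousAt.comp (hρ 0).continuousAt).div (hρ 0).continuousAt hρ0
    refine (hc.tendsto.mono_left nhdsWithin_le_nhds).congr' ?_
    filter_upwards [self_mem_nhdsWithin] with s hs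
    have : s ≠ 0 := hs
    simp [slope_def_field]
    field_simp
  have h4 := h2.unique h3
  rw [zero_smul, add_zero] at h4
  rw [h4]
  -- Here ρ 0 = |r|; oddness of B makes B(|r|)/|r| equal to B(r)/r for either sign of r.
  have hodd : B (-r) = -B r := by
    simp only [hB, ← integral_neg]
    simp [inner_neg_left]
  rcases abs_choice r with h | h <;> simp only [ρ, zero_pow, ne_eq, OfNat.ofNat_ne_zero,
    not_false_eq_true, add_zero, Real.sqrt_sq_eq_abs, h]
  · rfl
  · rw [hodd, neg_div_neg_eq]

/-- The Helmholtz equation in radial form. As |v|² = 1, A is the sum of the integrals C_j weighted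
by v_j². The radial term is C_0 = -A'', and each of the n transverse terms equals B/r = -A'/r by
`integral_sphere_sq_mul_cos`. -/
theorem isBesselSolution_integral_sphere (n : ℕ) : IsBesselSolution (n + 1) fun r =>
    ∫ v : USphere n, Real.cos (inner ℝ (r • stdVec 0) (v : Space (n + 1))) ∂(sphereProb n) := by
  set A : ℝ → ℝ := fun r => ∫ v : USphere n, Real.cos (inner ℝ (r • stdVec 0) (v : Space (n + 1))) ∂(sphereProb n)
  let B : ℝ → ℝ := fun r => ∫ v : USphere n, inner ℝ (stdVec 0) (v : Space (n + 1)) *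
        Real.sin (inner ℝ (r • stdVec 0) (v : Space (n + 1))) ∂(sphereProb n)
  let C : Fin (n + 1) → ℝ → ℝ := fun j r =>
    ∫ v : USphere n, inner ℝ (stdVec j) (v : Space (n + 1)) ^ 2 *
        Real.cos (inner ℝ (r • stdVec 0) (v : Space (n + 1))) ∂(sphereProb n)
  have hA : ∀ s, HasDerivAt A (-B s) s := fun s => by
    simpa using hasDerivAt_integral_sphere_cos (0 : Space (n + 1)) (stdVec 0) s
  have hB : ∀ s, HasDerivAt B (C 0 s) s := fun s => by
    simpa using hasDerivAt_integral_sphere_mul_sin (0 : Space (n + 1)) (stdVec 0) s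
  have hC : Continuous (C 0) := by
    refine continuous_integral_of_compactSpace _ ?_
    fun_prop
  have hA' : deriv A = fun s => -B s := funext fun s => (hA s).deriv
  have hA'' : deriv (deriv A) = fun s => -C 0 s := by
    rw [hA']
    exact funext fun s => (hB s).neg.deriv
  refine ⟨?_, ?_, ?_, fun r hr => ?_⟩
  · rw [show (2 : WithTop ℕ∞) = 1 + 1 by norm_num, contDiff_succ_iff_deriv]
    refine ⟨fun r => (hA r).differentiableAt, by simp, ?_⟩
    rw [contDiff_one_iff_deriv]
    refine ⟨?_, ?_⟩
    · rw [hA']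
      exact fun r => (hB r).neg.differentiableAt
    · rw [hA'']
      exact hC.neg
  · simp [A]
  · simp [hA', B]
  · have hsum : A r = ∑ j, C j r := by
      simp only [A, C]
      rw [← integral_finsetSum]
      · refine integral_congr_ae (.of_forall fun v => ?_)
        simp only [← Finset.sum_mul, inner_stdVec_left]
        have hv : ‖(v : Space (n + 1))‖ = 1 := by simp
        rw [EuclideanSpace.norm_eq, Real.sqrt_eq_one] at hv
        simp only [Real.norm_eq_abs, sq_abs] at hv
        rw [hv, one_mul]
      · exact fun j _ => integrable_of_compactSpace _ (by fun_prop)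
    have hCj : ∀ j : Fin n, C j.succ r = B r / r := fun j =>
      integral_sphere_sq_mul_cos (Fin.succ_ne_zero j) hr
    rw [hA'', hA', hsum, Fin.sum_univ_succ]
    simp only [hCj, Finset.sum_const, Finset.card_univ, Fintype.card_fin, nsmul_eq_mul]
    push_cast
    ring

/-- The Fourier transform of the normalized surface measure of the unit sphere. -/
theorem integral_sphere_cos (n : ℕ) (ξ : Space (n + 1)) :
    ∫ v : USphere n, Real.cos (inner ℝ ξ v) ∂(sphereProb n) = besselPhi (n + 1) ‖ξ‖ := by
  rw [← (isBesselSolution_integral_sphere n).eq_besselPhi (by omega)]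
  exact integral_sphere_cos_congr (by simp [norm_smul])

/-- An average of cosines over a probability measure. This gives the bound needed to construct
φ_{q+2}(tD). -/
theorem abs_besselPhi_le_one {n : ℕ} (r : ℝ) : |besselPhi (n + 1) r| ≤ 1 := by
  rw [← (isBesselSolution_integral_sphere n).eq_besselPhi (by omega)]
  have h := norm_integral_le_of_norm_le_const (μ := sphereProb n) (C := 1)
    (f := fun v => Real.cos (inner ℝ (r • stdVec 0) (v : Space (n + 1))))
    (.of_forall fun v => Real.abs_cos_le_one _)
  simpa using h

/-- Differentiate `integral_sphere_cos` at ξ in the direction η. Writing φ as a power series in |ξ|²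
avoids the non-differentiability of the norm at the origin. -/
theorem integral_sphere_mul_sin {n : ℕ} (ξ η : Space (n + 1)) :
    ∫ v : USphere n, inner ℝ η (v : Space (n + 1)) * Real.sin (inner ℝ ξ v) ∂(sphereProb n) =
      inner ℝ ξ η / (n + 1) * besselPhi (n + 3) ‖ξ‖ := by
  have h1 := hasDerivAt_integral_sphere_cos ξ η 0
  simp only [integral_sphere_cos, besselPhi_eq_besselSeries, zero_smul, add_zero] at h1
  have h2 : HasDerivAt (fun s : ℝ => ‖ξ + s • η‖ ^ 2) (2 * inner ℝ ξ η) 0 := by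
    have h := (((hasDerivAt_id (0 : ℝ)).smul_const η).const_add ξ).norm_sq
    simpa using h
  have h3 := ((hasDerivAt_besselSeries (n := n + 1) (by omega) _).comp (0 : ℝ) h2)
  have h4 := h1.unique h3
  rw [besselPhi_eq_besselSeries]
  simp only [zero_smul, add_zero] at h4
  push_cast at h4
  have : (n : ℝ) + 1 ≠ 0 := by positivity
  field_simp at h4 ⊢
  linear_combination -h4

/-- The Fourier transform of the unit normal field of the unit sphere. -/
theorem integral_sphere_smul_exp {n : ℕ} (ξ : Space (n + 1)) (i : Fin (n + 1)) :
    ∫ v : USphere n, ((v : Space (n + 1)) i : ℂ) *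
        Complex.exp (Complex.I * (inner ℝ ξ (v : Space (n + 1)) : ℝ)) ∂(sphereProb n) =
      Complex.I * (ξ i / (n + 1) * besselPhi (n + 3) ‖ξ‖ : ℝ) := by
  have e : ∀ v : USphere n, ((v : Space (n + 1)) i : ℂ) *
        Complex.exp (Complex.I * (inner ℝ ξ (v : Space (n + 1)) : ℝ)) =
      ((inner ℝ (stdVec i) (v : Space (n + 1)) * Real.cos (inner ℝ ξ v) : ℝ) : ℂ) +
        Complex.I * ((inner ℝ (stdVec i) (v : Space (n + 1)) * Real.sin (inner ℝ ξ v) : ℝ) : ℂ) := by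
    intro v
    rw [mul_comm Complex.I, Complex.exp_mul_I, inner_stdVec_left]
    push_cast
    ring
  simp_rw [e]
  -- The cosine part is odd in v and integrates to zero; only the sine part remains.
  rw [integral_add, integral_const_mul, integral_complex_ofReal, integral_complex_ofReal,
    integral_sphere_mul_sin, real_inner_comm, inner_stdVec_left, integral_sphere_odd
      (g := fun v => inner ℝ (stdVec i) v * Real.cos (inner ℝ ξ v))]
  · simp
  · intro v
    simp [inner_neg_right]
  · exact integrable_of_compactSpace _ (by fun_prop)
  · exact integrable_of_compactSpace _ (by fun_prop)

/-! ### The Clifford relations and functions of the Dirac operator -/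

/-- The sign `(-1)^{#{j ∈ I : j < i}}`. -/
noncomputable def wedgeSign {q : ℕ} (I : Finset (Fin q)) (i : Fin q) : ℂ :=
  (-1 : ℂ) ^ (I.filter (· < i)).card

theorem wedgeSign_mul_self {q : ℕ} (I : Finset (Fin q)) (i : Fin q) :
    wedgeSign I i * wedgeSign I i = 1 := by
  rw [wedgeSign, ← mul_pow]
  simp

theorem conj_wedgeSign {q : ℕ} (I : Finset (Fin q)) (i : Fin q) :
    (starRingEnd ℂ) (wedgeSign I i) = wedgeSign I i := by
  simp [wedgeSign]

theorem wedgeSign_insert {q : ℕ} {I : Finset (Fin q)} {i : Fin q} (hi : i ∉ I) (j : Fin q) :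
    wedgeSign (insert i I) j = if i < j then -wedgeSign I j else wedgeSign I j := by
  rw [wedgeSign, wedgeSign, Finset.filter_insert]
  split_ifs
  · rw [Finset.card_insert_of_notMem (by simp [hi]), pow_succ]
    ring
  · rfl

theorem wedgeSign_erase {q : ℕ} {I : Finset (Fin q)} {i : Fin q} (hi : i ∈ I) (j : Fin q) :
    wedgeSign (I.erase i) j = if i < j then -wedgeSign I j else wedgeSign I j := by
  have h := wedgeSign_insert (Finset.notMem_erase i I) j
  rw [Finset.insert_erase hi] at h
  split_ifs at h ⊢ <;> simp [h]

theorem wedge_apply {q : ℕ} (i : Fin q) (ω : FormFiber q) (I : Finset (Fin q)) :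
    wedge i ω I = if i ∈ I then wedgeSign I i * ω (I.erase i) else 0 :=
  rfl

/-- The coefficient at I is the inner product with dx_I, and adjointness moves the contraction onto
dx_I as a wedge product. -/
theorem contract_apply {q : ℕ} (i : Fin q) (ω : FormFiber q) (I : Finset (Fin q)) :
    contract i ω I = if i ∈ I then 0 else wedgeSign I i * ω (insert i I) := by
  have h : contract i ω I = inner ℂ (wedge i (EuclideanSpace.single I (1 : ℂ))) ω := by
    rw [← ContinuousLinearMap.adjoint_inner_right, ← contract, EuclideanSpace.inner_single_left]
    simp
  rw [h, PiLp.inner_apply]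
  simp only [wedge_apply]
  split_ifs with hi
  · refine Finset.sum_eq_zero fun J _ => ?_
    have : J.erase i ≠ I := fun h => Finset.notMem_erase i J (h ▸ hi)
    simp [this]
  · rw [Finset.sum_eq_single (insert i I)]
    · simp [hi, wedgeSign_insert hi, conj_wedgeSign, mul_comm]
    · intro J _ hJ
      by_cases hiJ : i ∈ J
      · have : J.erase i ≠ I := fun h => hJ (by rw [← h, Finset.insert_erase hiJ])
        simp [this]
      · simp [hiJ]
    · simp

theorem wedge_wedge {q : ℕ} (i j : Fin q) (ω : FormFiber q) :
    wedge i (wedge j ω) + wedge j (wedge i ω) = 0 := by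
  ext I
  simp only [PiLp.add_apply, wedge_apply, Finset.mem_erase, PiLp.zero_apply]
  rcases lt_trichotomy i j with h | rfl | h
  · by_cases hi : i ∈ I <;> by_cases hj : j ∈ I <;>
      simp [hi, hj, h.ne, h.ne', wedgeSign_erase, h, h.not_gt, Finset.erase_right_comm (a := i) (b := j)]
    ring
  · simp
  · by_cases hi : i ∈ I <;> by_cases hj : j ∈ I <;>
      simp [hi, hj, h.ne, h.ne', wedgeSign_erase, h, h.not_gt, Finset.erase_right_comm (a := i) (b := j)]
    ring

theorem contract_contract {q : ℕ} (i j : Fin q) (ω : FormFiber q) :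
    contract i (contract j ω) + contract j (contract i ω) = 0 := by
  refine ext_inner_right ℂ fun η => ?_
  simp only [contract, inner_add_left, ContinuousLinearMap.adjoint_inner_left]
  rw [← inner_add_right, wedge_wedge]
  simp

theorem wedge_contract {q : ℕ} (i j : Fin q) (ω : FormFiber q) :
    wedge i (contract j ω) + contract j (wedge i ω) = if i = j then ω else 0 := by
  ext I
  simp only [PiLp.add_apply, wedge_apply, contract_apply, Finset.mem_erase, Finset.mem_insert]
  by_cases hij : i = j
  · subst hij
    by_cases hi : i ∈ I
    · simp [hi, wedgeSign_erase, ← mul_assoc, wedgeSign_mul_self]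
    · simp [hi, wedgeSign_insert, ← mul_assoc, wedgeSign_mul_self]
  · have hji : j ≠ i := fun h => hij h.symm
    by_cases hi : i ∈ I <;> by_cases hj : j ∈ I <;> simp [hi, hj, hij, hji]
    rw [wedgeSign_erase hi, wedgeSign_insert hj, Finset.erase_insert_of_ne hji]
    rcases lt_or_gt_of_ne hij with h | h <;> simp [h, h.not_gt] <;> ring

theorem clifford_relation {q : ℕ} (i j : Fin q) :
    (wedge i - contract i) * (wedge j - contract j) + (wedge j - contract j) * (wedge i - contract i) =
      if i = j then (-2 : ℂ) • (1 : FormFiber q →L[ℂ] FormFiber q) else 0 := by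
  ext1 ω
  have h1 := wedge_wedge i j ω
  have h2 := contract_contract i j ω
  have h3 := wedge_contract i j ω
  have h4 := wedge_contract j i ω
  have e : ((wedge i - contract i) * (wedge j - contract j) +
      (wedge j - contract j) * (wedge i - contract i)) ω =
      (wedge i (wedge j ω) + wedge j (wedge i ω)) + (contract i (contract j ω) +
      contract j (contract i ω)) - (wedge i (contract j ω) + contract j (wedge i ω)) -
      (wedge j (contract i ω) + contract i (wedge j ω)) := by
    simp only [_root_.add_apply, mul_apply_eq_comp, _root_.sub_apply, map_sub]
    abel
  rw [e, h1, h2, h3, h4]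
  by_cases h : i = j
  · subst h
    simp
    module
  · simp [h, Ne.symm h]

/-- Symmetrizing the double sum turns products of Clifford generators into anticommutators, so only
the diagonal survives. The factor i² cancels the minus sign in the Clifford relation. -/
theorem diracSymbol_mul_self {q : ℕ} (ξ : Space q) :
    diracSymbol ξ * diracSymbol ξ = algebraMap ℝ _ ((2 * π * ‖ξ‖) ^ 2) := by
  have hdouble : ∀ A : FormFiber q →L[ℂ] FormFiber q, (2 : ℂ) • A = A + A := fun A => by
    ext1 x
    exact two_smul ℂ (A x)
  have h0 : ∀ c : ℂ, c • (0 : FormFiber q →L[ℂ] FormFiber q) = 0 := fun c => by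
    ext1 x
    exact smul_zero c
  have h2 : (2 : ℂ) • (diracSymbol ξ * diracSymbol ξ) =
      (2 : ℂ) • algebraMap ℝ (FormFiber q →L[ℂ] FormFiber q) ((2 * π * ‖ξ‖) ^ 2) := by
    have e : (2 : ℂ) • (diracSymbol ξ * diracSymbol ξ) =
        ∑ i, ∑ j, ((2 * π * Complex.I * (ξ i : ℂ)) * (2 * π * Complex.I * (ξ j : ℂ))) •
          ((wedge i - contract i) * (wedge j - contract j) +
            (wedge j - contract j) * (wedge i - contract i)) := by
      simp only [smul_add, Finset.sum_add_distrib]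
      rw [hdouble]
      congr 1
      · simp only [diracSymbol, Finset.sum_mul_sum, smul_mul_smul_comm]
      · rw [Finset.sum_comm]
        simp only [diracSymbol, Finset.sum_mul_sum, smul_mul_smul_comm]
        refine Finset.sum_congr rfl fun i _ => Finset.sum_congr rfl fun j _ => ?_
        rw [mul_comm (2 * π * Complex.I * (ξ j : ℂ))]
    rw [e]
    simp only [clifford_relation, smul_ite, h0, Finset.sum_ite_eq, Finset.mem_univ, if_true,
      smul_smul, ← Finset.sum_smul]
    rw [Algebra.algebraMap_eq_smul_one, ← Complex.coe_smul, smul_smul]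
    congr 1
    rw [mul_pow, EuclideanSpace.real_norm_sq_eq]
    push_cast
    rw [Finset.mul_sum, Finset.mul_sum]
    refine Finset.sum_congr rfl fun i _ => ?_
    linear_combination (-8 * (π : ℂ) ^ 2 * (ξ i : ℂ) ^ 2) * Complex.I_sq
  exact smul_right_injective _ (two_ne_zero (α := ℂ)) h2

/-- An even function of the Dirac operator acts by scalars in the frequency domain. -/
theorem cfc_diracSymbol {q : ℕ} (G : ℝ → ℝ) (ξ : Space q) :
    cfc (fun r => G (r ^ 2)) (diracSymbol ξ) =
      algebraMap ℝ (FormFiber q →L[ℂ] FormFiber q) (G ((2 * π * ‖ξ‖) ^ 2)) := by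
  -- Every spectral value r satisfies r² = (2π|ξ|)², so the function is constant on the spectrum.
  rw [cfc_congr (g := fun _ => G ((2 * π * ‖ξ‖) ^ 2)), cfc_const _ _ (isSelfAdjoint_diracSymbol ξ)]
  intro r hr
  have h := spectrum.pow_mem_pow (diracSymbol ξ) 2 hr
  rw [sq (diracSymbol ξ), diracSymbol_mul_self, spectrum.scalar_eq] at h
  simp only [Set.mem_singleton_iff.1 h]

/-! ### Fourier multipliers on square integrable forms -/

/-- `B` acts as multiplication by the matrix `M` in the frequency domain. -/
def IsFourierMultiplier {q : ℕ} (M : Space q → FormFiber q →L[ℂ] FormFiber q)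
    (B : FormL2 q →L[ℂ] FormL2 q) : Prop :=
  ∀ f : FormL2 q, ∀ᵐ ξ, (𝓕 (B f) : FormL2 q) ξ = M ξ ((𝓕 f : FormL2 q) ξ)

/-- Pointwise multiplication by a bounded continuous matrix function is bounded on L²; conjugate it
with the Plancherel isometry. -/
theorem exists_isFourierMultiplier {q : ℕ} {M : Space q → FormFiber q →L[ℂ] FormFiber q}
    (hM : Continuous M) {C : ℝ} (hC : ∀ ξ, ‖M ξ‖ ≤ C) :
    ∃ B : FormL2 q →L[ℂ] FormL2 q, IsFourierMultiplier M B := by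
  have hbd : ∀ (f : FormL2 q) ξ, ‖M ξ (f ξ)‖ ≤ C * ‖f ξ‖ := fun f ξ =>
    (M ξ).le_of_opNorm_le (hC ξ) _
  have hmem : ∀ f : FormL2 q, MemLp (fun ξ => M ξ (f ξ)) 2 volume := fun f =>
    (Lp.memLp f).of_le_mul (c := C)
      ((ContinuousLinearMap.id ℂ _).aestronglyMeasurable_comp₂ hM.aestronglyMeasurable
        (Lp.aestronglyMeasurable f)) (.of_forall (hbd f))
  let L : FormL2 q →ₗ[ℂ] FormL2 q :=
    { toFun := fun f => (hmem f).toLp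
      map_add' := fun f g => by
        ext1
        filter_upwards [(hmem (f + g)).coeFn_toLp, (hmem f).coeFn_toLp, (hmem g).coeFn_toLp,
          Lp.coeFn_add f g, Lp.coeFn_add (hmem f).toLp (hmem g).toLp] with ξ h1 h2 h3 h4 h5
        rw [h1, h5, Pi.add_apply, h2, h3, h4, Pi.add_apply, map_add]
      map_smul' := fun c f => by
        ext1
        filter_upwards [(hmem (c • f)).coeFn_toLp, (hmem f).coeFn_toLp, Lp.coeFn_smul c f,
          Lp.coeFn_smul c (hmem f).toLp] with ξ h1 h2 h3 h4
        rw [h1, RingHom.id_apply, h4, Pi.smul_apply, h2, h3, Pi.smul_apply, map_smul] }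
  have hL : ∀ f, ‖L f‖ ≤ C * ‖f‖ := fun f => by
    refine Lp.norm_le_mul_norm_of_ae_le_mul ?_
    filter_upwards [(hmem f).coeFn_toLp] with ξ h
    exact h ▸ hbd f ξ
  let F := (Lp.fourierTransformₗᵢ (Space q) (FormFiber q)).toContinuousLinearEquiv
  refine ⟨F.symm.toContinuousLinearMap ∘L L.mkContinuous C hL ∘L F.toContinuousLinearMap,
    fun f => ?_⟩
  have e : 𝓕 ((F.symm.toContinuousLinearMap ∘L L.mkContinuous C hL ∘L F.toContinuousLinearMap) f) =
      L (𝓕 f) :=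
    F.apply_symm_apply (L (𝓕 f))
  rw [e]
  exact (hmem (𝓕 f)).coeFn_toLp

theorem IsFourierMultiplier.unique {q : ℕ} {M : Space q → FormFiber q →L[ℂ] FormFiber q}
    {B B' : FormL2 q →L[ℂ] FormL2 q} (h : IsFourierMultiplier M B) (h' : IsFourierMultiplier M B') :
    B = B' := by
  ext1 f
  apply (Lp.fourierTransformₗᵢ (Space q) (FormFiber q)).injective
  change 𝓕 (B f) = 𝓕 (B' f)
  ext1
  filter_upwards [h f, h' f] with ξ h1 h2
  rw [h1, h2]

/-! ### The symbol of the deformed exterior derivative -/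

/-- Exterior multiplication by the covector `v♭ = ∑ᵢ vᵢ dx_i`. -/
noncomputable def wedgeVec {q : ℕ} (v : Space q) : FormFiber q →L[ℂ] FormFiber q :=
  ∑ i, (v i : ℂ) • wedge i

/-- Interior multiplication by the vector `v`. -/
noncomputable def contractVec {q : ℕ} (v : Space q) : FormFiber q →L[ℂ] FormFiber q :=
  ∑ i, (v i : ℂ) • contract i

theorem wedgeVec_apply {q : ℕ} (v : Space q) (x : FormFiber q) :
    wedgeVec v x = ∑ i, (v i : ℂ) • wedge i x := by
  simp [wedgeVec]

theorem contractVec_apply {q : ℕ} (v : Space q) (x : FormFiber q) :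
    contractVec v x = ∑ i, (v i : ℂ) • contract i x := by
  simp [contractVec]

theorem continuous_wedgeVec {q : ℕ} : Continuous (wedgeVec (q := q)) := by
  unfold wedgeVec
  fun_prop

theorem continuous_contractVec {q : ℕ} : Continuous (contractVec (q := q)) := by
  unfold contractVec
  fun_prop

theorem inner_contractVec_left {q : ℕ} (v : Space q) (x y : FormFiber q) :
    inner ℂ (contractVec v x) y = inner ℂ x (wedgeVec v y) := by
  simp only [contractVec_apply, wedgeVec_apply, sum_inner, inner_sum, inner_smul_left,
    inner_smul_right, Complex.conj_ofReal, contract, ContinuousLinearMap.adjoint_inner_left]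

/-- The symbol of the deformed exterior derivative `t φ_{q+2}(tD) d`. -/
noncomputable def deformedSymbol {q : ℕ} (t : ℝ) (ξ : Space q) : FormFiber q →L[ℂ] FormFiber q :=
  ((t * besselPhi (q + 2) (t * (2 * π * ‖ξ‖)) : ℝ) * (2 * π * Complex.I) : ℂ) • wedgeVec ξ

theorem continuous_deformedSymbol {q : ℕ} (t : ℝ) : Continuous (deformedSymbol (q := q) t) := by
  have h := continuous_besselPhi (n := q + 2) (by omega)
  have h2 := continuous_wedgeVec (q := q)
  have h3 : Continuous fun ξ : Space q =>
      ((t * besselPhi (q + 2) (t * (2 * π * ‖ξ‖)) : ℝ) * (2 * π * Complex.I) : ℂ) := by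
    fun_prop
  exact h3.smul h2

/-- The symbol is the Fourier transform of the normal field of the sphere of radius `t`. -/
theorem deformedSymbol_apply {n : ℕ} {t : ℝ} (ht : 0 < t) (ξ : Space (n + 1))
    (x : FormFiber (n + 1)) :
    deformedSymbol t ξ x = ((n + 1 : ℕ) : ℂ) • ∫ v : USphere n,
      Complex.exp (Complex.I * (inner ℝ ((2 * π * t) • ξ) (v : Space (n + 1)) : ℝ)) •
        wedgeVec (v : Space (n + 1)) x ∂(sphereProb n) := by
  have e : ∀ v : USphere n,
      Complex.exp (Complex.I * (inner ℝ ((2 * π * t) • ξ) (v : Space (n + 1)) : ℝ)) •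
        wedgeVec (v : Space (n + 1)) x =
      ∑ i, (((v : Space (n + 1)) i : ℂ) *
        Complex.exp (Complex.I * (inner ℝ ((2 * π * t) • ξ) (v : Space (n + 1)) : ℝ))) •
          wedge i x := by
    intro v
    rw [wedgeVec_apply, Finset.smul_sum]
    refine Finset.sum_congr rfl fun i _ => ?_
    rw [smul_smul, mul_comm]
  simp only [e]
  rw [integral_finsetSum _ fun i _ => integrable_of_compactSpace _ (by fun_prop)]
  simp only [integral_smul_const, integral_sphere_smul_exp]
  rw [deformedSymbol, _root_.smul_apply, wedgeVec_apply, Finset.smul_sum, Finset.smul_sum]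
  refine Finset.sum_congr rfl fun i _ => ?_
  -- The frequency 2πtξ combines the radius t with the 2π of the Fourier convention. It also
  -- supplies the factor 2πt of the symbol, while the n + 1 in the denominator cancels the prefactor
  -- q.
  have hn : ‖(2 * π * t) • ξ‖ = t * (2 * π * ‖ξ‖) := by
    rw [norm_smul, Real.norm_of_nonneg (by positivity)]
    ring
  rw [smul_smul, smul_smul, hn]
  congr 1
  have h1 : ((n : ℂ) + 1) ≠ 0 := by exact_mod_cast n.succ_ne_zero
  simp only [PiLp.smul_apply, smul_eq_mul]
  push_cast
  field_simp

theorem exists_norm_wedgeVec_le (n : ℕ) : ∃ C : ℝ, ∀ v : USphere n,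
    ‖wedgeVec (v : Space (n + 1))‖ ≤ C := by
  obtain ⟨C, hC⟩ := (isCompact_univ (X := USphere n)).exists_bound_of_continuousOn
    (f := fun v => wedgeVec (v : Space (n + 1)))
    (continuous_wedgeVec.comp continuous_subtype_val).continuousOn
  exact ⟨C, fun v => hC v (Set.mem_univ _)⟩

theorem norm_exp_I_mul_ofReal (a : ℝ) : ‖Complex.exp (Complex.I * a)‖ = 1 := by
  rw [mul_comm, Complex.norm_exp_ofReal_mul_I]

/-- The symbol is the transform of a finite vector measure, so no decay estimate for φ_{q+2} is
needed to offset the growth of ξ. -/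
theorem exists_norm_deformedSymbol_le {n : ℕ} {t : ℝ} (ht : 0 < t) :
    ∃ C : ℝ, ∀ ξ : Space (n + 1), ‖deformedSymbol t ξ‖ ≤ C := by
  obtain ⟨C, hC⟩ := exists_norm_wedgeVec_le n
  have hC0 : 0 ≤ C := (norm_nonneg _).trans (hC ⟨stdVec 0, by simp⟩)
  refine ⟨(n + 1) * C, fun ξ => ContinuousLinearMap.opNorm_le_bound _ (by positivity) fun x => ?_⟩
  rw [deformedSymbol_apply ht, norm_smul, mul_assoc (_ + 1), Complex.norm_natCast]
  push_cast
  refine mul_le_mul_of_nonneg_left ?_ (by positivity : (0 : ℝ) ≤ n + 1)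
  rw [← mul_one (C * ‖x‖), ← probReal_univ (μ := sphereProb n)]
  refine norm_integral_le_of_norm_le_const (.of_forall fun v => ?_)
  rw [norm_smul, norm_exp_I_mul_ofReal, one_mul]
  exact ContinuousLinearMap.le_of_opNorm_le _ (hC v) x

theorem fourier_postcompCLM {q : ℕ} (L : FormFiber q →L[ℂ] FormFiber q)
    (η : 𝓢(Space q, FormFiber q)) : 𝓕 (postcompCLM L η) = postcompCLM L (𝓕 η) := by
  ext1 ξ
  rw [postcompCLM_apply, SchwartzMap.fourier_coe, SchwartzMap.fourier_coe, Real.fourier_eq,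
    Real.fourier_eq, ← L.integral_comp_comm]
  · congr 1
    ext1 v
    rw [postcompCLM_apply, Circle.smul_def, Circle.smul_def, map_smul]
  · rw [Real.fourierIntegral_convergent_iff]
    exact η.integrable

theorem fourier_extD {q : ℕ} (ω : 𝓢(Space q, FormFiber q)) (ξ : Space q) :
    𝓕 (extD ω) ξ = (2 * π * Complex.I : ℂ) • wedgeVec ξ (𝓕 ω ξ) := by
  have hd : ∀ i : Fin q, 𝓕 (∂_{stdVec i} ω) ξ = (2 * π * Complex.I * (ξ i : ℂ)) • 𝓕 ω ξ := by
    intro i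
    have ht : (inner ℝ · (stdVec i) : Space q → ℝ).HasTemperateGrowth :=
      ((innerSL ℝ).flip (stdVec i)).hasTemperateGrowth
    rw [fourier_lineDerivOp_eq, _root_.smul_apply, smulLeftCLM_apply_apply ht]
    have hi : inner ℝ ξ (stdVec i) = ξ i := by simp [EuclideanSpace.inner_single_right]
    rw [hi, mul_smul (2 * π * Complex.I : ℂ), Complex.coe_smul]
  simp only [extD, FourierTransform.fourier_sum, fourier_postcompCLM, _root_.sum_apply,
    postcompCLM_apply, hd, map_smul, wedgeVec_apply, Finset.smul_sum, smul_smul]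

theorem cfc_besselPhi_diracSymbol {q : ℕ} (t : ℝ) (ξ : Space q) :
    cfc (fun r => besselPhi (q + 2) (t * r)) (diracSymbol ξ) =
      algebraMap ℝ (FormFiber q →L[ℂ] FormFiber q) (besselPhi (q + 2) (t * (2 * π * ‖ξ‖))) := by
  have h := cfc_diracSymbol (fun x => besselSeries (q + 2) (t ^ 2 * x)) ξ
  simpa only [besselPhi_eq_besselSeries, mul_pow] using h

theorem exists_isFunctionOfDirac {q : ℕ} (t : ℝ) : ∃ Φ : FormL2 q →L[ℂ] FormL2 q,
    IsFunctionOfDirac (fun r => besselPhi (q + 2) (t * r)) Φ := by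
  have hc := continuous_besselPhi (n := q + 2) (by omega)
  obtain ⟨Φ, hΦ⟩ := exists_isFourierMultiplier (q := q)
    (M := fun ξ => cfc (fun r => besselPhi (q + 2) (t * r)) (diracSymbol ξ)) (C := 1)
    (by
      simp only [cfc_besselPhi_diracSymbol]
      exact (algebraMapCLM ℝ (FormFiber q →L[ℂ] FormFiber q)).continuous.comp (by fun_prop))
    (fun ξ => by
      rw [cfc_besselPhi_diracSymbol, norm_algebraMap']
      exact abs_besselPhi_le_one _)
  exact ⟨Φ, hΦ⟩

theorem IsFourierMultiplier.isDeformedExtD {q : ℕ} {t : ℝ} {T : FormL2 q →L[ℂ] FormL2 q}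
    (hT : IsFourierMultiplier (deformedSymbol t) T) : IsDeformedExtD t T := by
  obtain ⟨Φ, hΦ⟩ := exists_isFunctionOfDirac (q := q) t
  refine ⟨Φ, hΦ, fun ω => ?_⟩
  apply (Lp.fourierTransformₗᵢ (Space q) (FormFiber q)).injective
  rw [map_smul]
  change 𝓕 (T (ω.toLp 2)) = (t : ℂ) • 𝓕 (Φ ((extD ω).toLp 2))
  ext1
  have h1 := hT (ω.toLp 2)
  have h2 := hΦ ((extD ω).toLp 2)
  rw [SchwartzMap.toLp_fourier_eq] at h1 h2
  filter_upwards [h1, h2, (𝓕 ω).coeFn_toLp 2, (𝓕 (extD ω)).coeFn_toLp 2,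
    Lp.coeFn_smul (t : ℂ) (𝓕 (Φ ((extD ω).toLp 2)))] with ξ a1 a2 a3 a4 a5
  rw [a1, a5, Pi.smul_apply, a2, a3, a4, fourier_extD, cfc_besselPhi_diracSymbol,
    Algebra.algebraMap_eq_smul_one, deformedSymbol, _root_.smul_apply, _root_.smul_apply,
    ← Complex.coe_smul, one_apply_eq_self, smul_smul, smul_smul]
  push_cast
  rw [mul_assoc]

/-- The multiplier determines φ_{q+2}(tD), and density of the rapidly decreasing forms then
determines the extension. -/
theorem IsDeformedExtD.unique {q : ℕ} {t : ℝ} {T T' : FormL2 q →L[ℂ] FormL2 q}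
    (h : IsDeformedExtD t T) (h' : IsDeformedExtD t T') : T = T' := by
  obtain ⟨Φ, hΦ, hT⟩ := h
  obtain ⟨Φ', hΦ', hT'⟩ := h'
  obtain rfl : Φ = Φ' := IsFourierMultiplier.unique hΦ hΦ'
  have hd : DenseRange (SchwartzMap.toLpCLM ℂ (E := Space q) (FormFiber q) 2 volume) :=
    SchwartzMap.denseRange_toLpCLM ENNReal.ofNat_ne_top
  refine DFunLike.coe_injective (hd.equalizer T.continuous T'.continuous (funext fun ω => ?_))
  exact (hT ω).trans (hT' ω).symm

/-! ### The averaging operators -/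

/-- The operator `q ⨍_{|v| = 1} v♭ ∧ F(p + t v)` of averaging over spheres. -/
noncomputable def sphereAverage {n : ℕ} (t : ℝ) (F : Space (n + 1) → FormFiber (n + 1))
    (p : Space (n + 1)) : FormFiber (n + 1) :=
  ((n + 1 : ℕ) : ℂ) • ∫ v : USphere n, wedgeVec (v : Space (n + 1)) (F (p + t • v)) ∂(sphereProb n)

/-- The transposed averaging operator `q ⨍_{|v| = 1} ι_v F(x - t v)`. -/
noncomputable def sphereCoaverage {n : ℕ} (t : ℝ) (F : Space (n + 1) → FormFiber (n + 1))
    (x : Space (n + 1)) : FormFiber (n + 1) :=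
  ((n + 1 : ℕ) : ℂ) • ∫ v : USphere n,
    contractVec (v : Space (n + 1)) (F (x - t • v)) ∂(sphereProb n)

theorem continuous_sphereAverage {n : ℕ} (t : ℝ) {F : Space (n + 1) → FormFiber (n + 1)}
    (hF : Continuous F) : Continuous (sphereAverage t F) := by
  have := continuous_wedgeVec (q := n + 1)
  exact (continuous_integral_of_compactSpace (sphereProb n)
    (f := fun p v => wedgeVec (v : Space (n + 1)) (F (p + t • v))) (by fun_prop)).const_smul ((n + 1 : ℕ) : ℂ)

theorem continuous_sphereCoaverage {n : ℕ} (t : ℝ) {F : Space (n + 1) → FormFiber (n + 1)}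
    (hF : Continuous F) : Continuous (sphereCoaverage t F) := by
  have := continuous_contractVec (q := n + 1)
  exact (continuous_integral_of_compactSpace (sphereProb n)
    (f := fun x v => contractVec (v : Space (n + 1)) (F (x - t • v))) (by fun_prop)).const_smul ((n + 1 : ℕ) : ℂ)

/-- The shear `(x, v) ↦ (x + t v, v)` maps this compact set to one containing the support of
`(x, v) ↦ F (x - t v)`. -/
theorem isCompact_image_shear {n : ℕ} (t : ℝ) {F : Space (n + 1) → FormFiber (n + 1)}
    (hF : HasCompactSupport F) : IsCompact
      ((fun z : Space (n + 1) × USphere n => (z.1 + t • (z.2 : Space (n + 1)), z.2)) ''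
        (tsupport F ×ˢ Set.univ)) :=
  (hF.isCompact.prod isCompact_univ).image (by fun_prop)

theorem mem_image_shear {n : ℕ} {t : ℝ} {F : Space (n + 1) → FormFiber (n + 1)}
    {x : Space (n + 1)} {v : USphere n} (h : F (x - t • (v : Space (n + 1))) ≠ 0) :
    (x, v) ∈ (fun z : Space (n + 1) × USphere n => (z.1 + t • (z.2 : Space (n + 1)), z.2)) ''
        (tsupport F ×ˢ Set.univ) :=
  ⟨(x - t • (v : Space (n + 1)), v), ⟨subset_tsupport _ h, Set.mem_univ _⟩, by simp⟩

theorem hasCompactSupport_sphereCoaverage {n : ℕ} (t : ℝ)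
    {F : Space (n + 1) → FormFiber (n + 1)} (hF : HasCompactSupport F) :
    HasCompactSupport (sphereCoaverage t F) := by
  refine HasCompactSupport.intro ((isCompact_image_shear t hF).image continuous_fst) fun x hx => ?_
  have h : ∀ v : USphere n, F (x - t • (v : Space (n + 1))) = 0 := fun v => by
    by_contra h
    exact hx ⟨_, mem_image_shear h, rfl⟩
  simp [sphereCoaverage, h]

theorem integral_inner_sphereAverage {n : ℕ} (t : ℝ) {F G : Space (n + 1) → FormFiber (n + 1)}
    (hF : Continuous F) (hF' : HasCompactSupport F) (hG : Continuous G) :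
    ∫ x, inner ℂ (F x) (sphereAverage t G x) =
      ((n + 1 : ℕ) : ℂ) * ∫ v : USphere n, ∫ x,
        inner ℂ (F x) (wedgeVec (v : Space (n + 1)) (G (x + t • v))) ∂volume ∂(sphereProb n) := by
  have hw := continuous_wedgeVec (q := n + 1)
  rw [← integral_integral_swap_of_hasCompactSupport, ← integral_const_mul]
  · refine integral_congr_ae (.of_forall fun x => ?_)
    simp only [sphereAverage]
    rw [inner_smul_right, ← integral_inner]
    exact integrable_of_compactSpace _ (by fun_prop)
  · fun_prop
  · refine HasCompactSupport.intro (hF'.isCompact.prod isCompact_univ) fun z hz => ?_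
    have : F z.1 = 0 := by
      by_contra h
      exact hz ⟨subset_tsupport _ h, Set.mem_univ _⟩
    simp [Function.uncurry, this]

/-- Fubini, the adjointness of ι_v and v♭∧, and the translation x ↦ x + tv for each fixed v. Compact
support of F justifies the interchange although G may grow arbitrarily. -/
theorem integral_inner_sphereCoaverage {n : ℕ} (t : ℝ) {F G : Space (n + 1) → FormFiber (n + 1)}
    (hF : Continuous F) (hF' : HasCompactSupport F) (hG : Continuous G) :
    ∫ x, inner ℂ (sphereCoaverage t F x) (G x) = ∫ x, inner ℂ (F x) (sphereAverage t G x) := by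
  have hw := continuous_wedgeVec (q := n + 1)
  have hc := continuous_contractVec (q := n + 1)
  have e : ∀ x, inner ℂ (sphereCoaverage t F x) (G x) = ((n + 1 : ℕ) : ℂ) * ∫ v : USphere n,
      inner ℂ (F (x - t • v)) (wedgeVec (v : Space (n + 1)) (G x)) ∂(sphereProb n) := by
    intro x
    rw [sphereCoaverage, inner_smul_left, Complex.conj_natCast, ← inner_conj_symm, ← integral_inner,
      ← integral_conj]
    · simp only [inner_conj_symm, inner_contractVec_left]
    · exact integrable_of_compactSpace _ (by fun_prop)
  simp only [e]
  rw [integral_inner_sphereAverage t hF hF' hG, integral_const_mul,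
    integral_integral_swap_of_hasCompactSupport]
  · congr 1
    refine integral_congr_ae (.of_forall fun v => ?_)
    simp only
    rw [← integral_add_right_eq_self _ (t • (v : Space (n + 1)))]
    simp
  · fun_prop
  · refine HasCompactSupport.intro (isCompact_image_shear t hF') fun z hz => ?_
    have : F (z.1 - t • (z.2 : Space (n + 1))) = 0 := by
      by_contra h
      exact hz (mem_image_shear h)
    simp [Function.uncurry, this]

/-! ### Spherical averages in the frequency domain -/

theorem fourier_compSubConstCLM {q : ℕ} (ω : 𝓢(Space q, FormFiber q)) (a ξ : Space q) :
    𝓕 (compSubConstCLM ℂ (-a) ω) ξ =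
      Complex.exp (Complex.I * (inner ℝ ((2 * π) • ξ) a : ℝ)) • 𝓕 ω ξ := by
  have h := congrFun (VectorFourier.fourierIntegral_comp_add_right Real.fourierChar
    (volume : Measure (Space q)) (innerₗ (Space q)) ω a) ξ
  have h1 : 𝓕 (compSubConstCLM ℂ (-a) ω) ξ = VectorFourier.fourierIntegral Real.fourierChar
      (volume : Measure (Space q)) (innerₗ (Space q)) (ω ∘ fun v => v + a) ξ := by
    have h2 : (compSubConstCLM ℂ (-a) ω : Space q → FormFiber q) = ω ∘ fun v => v + a :=
      funext fun x => by simp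
    rw [SchwartzMap.fourier_coe, h2]
    rfl
  rw [h1, h, Circle.smul_def, Real.fourierChar_apply, innerₗ_apply_apply, real_inner_smul_left,
    real_inner_comm]
  congr 2
  push_cast
  ring

theorem inner_deformedSymbol {n : ℕ} {t : ℝ} (ht : 0 < t) (ξ : Space (n + 1))
    (x y : FormFiber (n + 1)) : inner ℂ x (deformedSymbol t ξ y) =
      ((n + 1 : ℕ) : ℂ) * ∫ v : USphere n, inner ℂ x
        (Complex.exp (Complex.I * (inner ℝ ((2 * π * t) • ξ) (v : Space (n + 1)) : ℝ)) •
          wedgeVec (v : Space (n + 1)) y) ∂(sphereProb n) := by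
  have hw := continuous_wedgeVec (q := n + 1)
  rw [deformedSymbol_apply ht, inner_smul_right, ← integral_inner]
  exact integrable_of_compactSpace _ (by fun_prop)

/-- Justifies Fubini: a is bounded, b is integrable, the phase has modulus one and the sphere has
finite measure. -/
theorem integrable_sphere_symbol {n : ℕ} (t : ℝ)
    (a b : 𝓢(Space (n + 1), FormFiber (n + 1))) :
    Integrable (Function.uncurry fun (ξ : Space (n + 1)) (v : USphere n) =>
      inner ℂ (a ξ) (Complex.exp (Complex.I *
        (inner ℝ ((2 * π * t) • ξ) (v : Space (n + 1)) : ℝ)) •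
          wedgeVec (v : Space (n + 1)) (b ξ))) (volume.prod (sphereProb n)) := by
  have hw := continuous_wedgeVec (q := n + 1)
  have ha := a.continuous
  have hb := b.continuous
  obtain ⟨C, hC⟩ := exists_norm_wedgeVec_le n
  refine Integrable.mono' (((b.integrable (μ := volume)).norm.const_mul
    (SchwartzMap.seminorm ℝ 0 0 a * C)).comp_fst (sphereProb n))
    (Continuous.aestronglyMeasurable (by fun_prop)) (.of_forall fun z => ?_)
  refine (norm_inner_le_norm _ _).trans ?_
  rw [norm_smul, norm_exp_I_mul_ofReal, one_mul, mul_assoc]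
  exact mul_le_mul (a.norm_le_seminorm ℝ z.1) (ContinuousLinearMap.le_of_opNorm_le _ (hC z.2) _)
    (norm_nonneg _) (by positivity)

/-- Plancherel for one fixed v: the phase is the transform of translation by tv, and the constant
matrix v♭∧ commutes with the Fourier transform. -/
theorem integral_inner_fourier_symbol {n : ℕ} (t : ℝ)
    (ψ ω : 𝓢(Space (n + 1), FormFiber (n + 1))) (v : Space (n + 1)) :
    ∫ ξ, inner ℂ (𝓕 ψ ξ) (Complex.exp (Complex.I * (inner ℝ ((2 * π * t) • ξ) v : ℝ)) •
      wedgeVec v (𝓕 ω ξ)) = ∫ x, inner ℂ (ψ x) (wedgeVec v (ω (x + t • v))) := by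
  have h := integral_inner_fourier_fourier ψ (postcompCLM (wedgeVec v)
    (compSubConstCLM ℂ (-(t • v)) ω))
  simp only [fourier_postcompCLM, postcompCLM_apply, fourier_compSubConstCLM,
    compSubConstCLM_apply, sub_neg_eq_add, map_smul] at h
  have e : ∀ ξ : Space (n + 1), inner ℝ ((2 * π * t) • ξ) v = inner ℝ ((2 * π) • ξ) (t • v) := by
    intro ξ
    simp only [real_inner_smul_left, real_inner_smul_right]
    ring
  simp only [e]
  exact h

theorem IsFourierMultiplier.inner_toLp_eq_integral {q : ℕ}
    {M : Space q → FormFiber q →L[ℂ] FormFiber q} {T : FormL2 q →L[ℂ] FormL2 q}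
    (hT : IsFourierMultiplier M T) (ψ ω : 𝓢(Space q, FormFiber q)) :
    inner ℂ (ψ.toLp 2) (T (ω.toLp 2)) = ∫ ξ, inner ℂ (𝓕 ψ ξ) (M ξ (𝓕 ω ξ)) := by
  rw [← Lp.inner_fourier_eq, SchwartzMap.toLp_fourier_eq, L2.inner_def]
  have h2 := hT (ω.toLp 2)
  rw [SchwartzMap.toLp_fourier_eq] at h2
  have h3 := (𝓕 ω).coeFn_toLp 2 volume
  have h4 := (𝓕 ψ).coeFn_toLp 2 volume
  refine integral_congr_ae ?_
  filter_upwards [h2, h3, h4] with ξ a1 a2 a3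
  rw [a1, a2, a3]

/-- On rapidly decreasing forms the multiplier is the averaging operator. -/
theorem IsFourierMultiplier.inner_toLp {n : ℕ} {t : ℝ} (ht : 0 < t)
    {T : FormL2 (n + 1) →L[ℂ] FormL2 (n + 1)} (hT : IsFourierMultiplier (deformedSymbol t) T)
    (ψ ω : 𝓢(Space (n + 1), FormFiber (n + 1))) (hψ : HasCompactSupport ψ) :
    inner ℂ (ψ.toLp 2) (T (ω.toLp 2)) = ∫ x, inner ℂ (ψ x) (sphereAverage t ω x) := by
  rw [hT.inner_toLp_eq_integral, integral_inner_sphereAverage t ψ.continuous hψ ω.continuous]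
  simp only [inner_deformedSymbol ht]
  rw [integral_const_mul, integral_integral_swap (integrable_sphere_symbol t (𝓕 ψ) (𝓕 ω))]
  simp only [integral_inner_fourier_symbol]

theorem memLp_sphereCoaverage {n : ℕ} (t : ℝ) {F : Space (n + 1) → FormFiber (n + 1)}
    (hF : Continuous F) (hF' : HasCompactSupport F) :
    MemLp (sphereCoaverage t F) 2 (volume : Measure (Space (n + 1))) :=
  (continuous_sphereCoaverage t hF).memLp_of_hasCompactSupport
    (hasCompactSupport_sphereCoaverage t hF')

theorem inner_memLp_toLp_schwartz {q : ℕ} {h : Space q → FormFiber q} (hh : MemLp h 2 volume)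
    (ω : 𝓢(Space q, FormFiber q)) :
    inner ℂ hh.toLp (ω.toLp 2) = ∫ x, inner ℂ (h x) (ω x) := by
  rw [L2.inner_def]
  have h3 := hh.coeFn_toLp
  have h4 := ω.coeFn_toLp 2 volume
  refine integral_congr_ae ?_
  filter_upwards [h3, h4] with x a1 a2
  rw [a1, a2]

theorem formL2_ext_schwartz {q : ℕ} {f g : FormL2 q}
    (h : ∀ ω : 𝓢(Space q, FormFiber q), inner ℂ f (ω.toLp 2) = inner ℂ g (ω.toLp 2)) : f = g := by
  have hd : DenseRange (SchwartzMap.toLpCLM ℂ (E := Space q) (FormFiber q) 2 volume) :=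
    SchwartzMap.denseRange_toLpCLM ENNReal.ofNat_ne_top
  exact ext_inner_right ℂ fun k => congrFun (hd.equalizer (innerSL ℂ f).continuous
    (innerSL ℂ g).continuous (funext h)) k

/-- Gives the adjoint of a test form a continuous representative with compact support. This is what
makes its pairing with an arbitrary continuous form converge. -/
theorem IsFourierMultiplier.adjoint_toLp {n : ℕ} {t : ℝ} (ht : 0 < t)
    {T : FormL2 (n + 1) →L[ℂ] FormL2 (n + 1)} (hT : IsFourierMultiplier (deformedSymbol t) T)
    (ψ : 𝓢(Space (n + 1), FormFiber (n + 1))) (hψ : HasCompactSupport ψ) :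
    ContinuousLinearMap.adjoint T (ψ.toLp 2) =
      (memLp_sphereCoaverage t ψ.continuous hψ).toLp := by
  refine formL2_ext_schwartz fun ω => ?_
  rw [ContinuousLinearMap.adjoint_inner_left, hT.inner_toLp ht ψ ω hψ,
    ← integral_inner_sphereCoaverage t ψ.continuous hψ ω.continuous, inner_memLp_toLp_schwartz]

/-! ### The average flux -/

/-- The linear form-valued map x ↦ ⟨ν, x⟩ α has exterior derivative ν♭ ∧ α, so `formCoords_extDeriv`
provides the comparison, signs included. In top degree only the full index set contributes. -/
theorem wedgeVec_formCoords {n : ℕ} (ν : Space (n + 1)) (α : Space (n + 1) [⋀^Fin n]→L[ℝ] ℂ) :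
    wedgeVec ν (formCoords α) = volForm (fluxDensity ν α) := by
  let f : Space (n + 1) → Space (n + 1) [⋀^Fin n]→L[ℝ] ℂ := (innerSL ℝ ν).smulRight α
  have hf : fderiv ℝ f 0 = (innerSL ℝ ν).smulRight α :=
    ((innerSL ℝ ν).smulRight α).fderiv
  have hfd : DifferentiableAt ℝ f 0 := ((innerSL ℝ ν).smulRight α).differentiableAt
  have h := formCoords_extDeriv f 0 hfd
  have h1 : ∀ i, fderiv ℝ (fun y => formCoords (f y)) 0 (stdVec i) = (ν i : ℂ) • formCoords α := by
    intro i
    have h2 : fderiv ℝ (fun y => formCoords (f y)) 0 = _ :=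
      ((formCoords (q := n + 1) (k := n)).hasFDerivAt.comp 0 hfd.hasFDerivAt).fderiv
    rw [h2, hf]
    simp [EuclideanSpace.inner_single_right, Complex.coe_smul]
  simp only [h1, map_smul, ← wedgeVec_apply] at h
  rw [← h]
  ext I
  rw [formCoords_apply, volForm]
  by_cases hI : I = Finset.univ
  · subst hI
    have hc : (Finset.univ : Finset (Fin (n + 1))).card = n + 1 := by simp
    have hid : ∀ j, (Finset.univ : Finset (Fin (n + 1))).orderEmbOfFin hc j = j := by
      intro j
      have := Finset.orderEmbOfFin_unique hc (f := id) (fun _ => Finset.mem_univ _) strictMono_id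
      exact (congrFun this j).symm
    rw [dif_pos hc, extDeriv, hf]
    simp only [hid]
    simp [fluxDensity]
  · have hc : I.card ≠ n + 1 := fun h => hI (by
      rw [← Finset.card_eq_iff_eq_univ]
      simpa using h)
    rw [dif_neg hc]
    simp [hI]

/-- The outward normal at p + tv is v, and the scaling tⁿ cancels between the flux and the area. -/
theorem averageFlux_eq {n : ℕ} {t : ℝ} (ht : 0 < t)
    {f : Space (n + 1) → Space (n + 1) [⋀^Fin n]→L[ℝ] ℂ} (hf : Continuous f) (p : Space (n + 1)) :
    averageFlux f t p = ∫ v : USphere n,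
      fluxDensity (v : Space (n + 1)) (f (p + t • v)) ∂(sphereProb n) := by
  have hw := continuous_wedgeVec (q := n + 1)
  have hfd : ∀ (ν : Space (n + 1)) α, fluxDensity ν α = wedgeVec ν (formCoords α) Finset.univ := by
    intro ν α
    simp [wedgeVec_formCoords, volForm]
  have hcont : Continuous fun x => fluxDensity (t⁻¹ • (x - p)) (f x) := by
    simp only [hfd]
    have := (formCoords (q := n + 1) (k := n)).continuous.comp hf
    fun_prop
  have hφ : Continuous fun v : USphere n => p + t • (v : Space (n + 1)) := by fun_prop
  have htn : (0 : ℝ) < t ^ n := by positivity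
  rw [averageFlux, flux, waveFrontMeasure, integral_smul_measure,
    integral_map hφ.aemeasurable hcont.aestronglyMeasurable, measureReal_ennreal_smul_apply,
    map_measureReal_apply hφ.measurable MeasurableSet.univ, Set.preimage_univ, sphereProb,
    integral_smul_measure, ENNReal.toReal_ofReal htn.le, ENNReal.toReal_inv, ← Measure.real]
  simp only [add_sub_cancel_left, smul_smul, inv_mul_cancel₀ ht.ne', one_smul, Complex.real_smul]
  push_cast
  rw [mul_inv, mul_comm ((t : ℂ) ^ n)⁻¹, mul_assoc, inv_mul_cancel_left₀]
  exact_mod_cast htn.ne'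

theorem sphereAverage_formCoords {n : ℕ} {t : ℝ} (ht : 0 < t)
    {f : Space (n + 1) → Space (n + 1) [⋀^Fin n]→L[ℝ] ℂ} (hf : Continuous f) (p : Space (n + 1)) :
    sphereAverage t (fun x => formCoords (f x)) p =
      volForm (((n + 1 : ℕ) : ℂ) * averageFlux f t p) := by
  have hvol : ∀ c : ℂ, volForm (q := n + 1) c = c • EuclideanSpace.single Finset.univ (1 : ℂ) := by
    intro c
    ext I
    simp [volForm]
  rw [averageFlux_eq ht hf, sphereAverage]
  simp only [wedgeVec_formCoords, hvol]
  rw [integral_smul_const, smul_smul]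

/-! ### Images in the sense of distributions and the main theorem -/

theorem isDistributionalImage_sphereAverage {n : ℕ} {t : ℝ} (ht : 0 < t)
    {T : FormL2 (n + 1) →L[ℂ] FormL2 (n + 1)} (hT : IsFourierMultiplier (deformedSymbol t) T)
    {F : Space (n + 1) → FormFiber (n + 1)} (hF : Continuous F) :
    IsDistributionalImage T F (sphereAverage t F) := by
  intro ψ hψ
  have hc := continuous_sphereCoaverage t ψ.continuous
  have hcs := hasCompactSupport_sphereCoaverage t hψ
  have hae : (fun x => inner ℂ (ContinuousLinearMap.adjoint T (ψ.toLp 2) x) (F x)) =ᵐ[volume]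
      fun x => inner ℂ (sphereCoaverage t ψ x) (F x) := by
    rw [hT.adjoint_toLp ht ψ hψ]
    filter_upwards [(memLp_sphereCoaverage t ψ.continuous hψ).coeFn_toLp] with x h
    rw [h]
  have hint : Integrable (fun x => inner ℂ (sphereCoaverage t ψ x) (F x)) volume := by
    refine (hc.inner hF).integrable_of_hasCompactSupport (hcs.mono' fun x hx => ?_)
    refine subset_tsupport _ fun h => hx ?_
    simp [h]
  refine ⟨hint.congr hae.symm, ?_⟩
  rw [integral_congr_ae hae]
  exact integral_inner_sphereCoaverage t ψ.continuous hψ hF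

theorem inner_memLp_toLp_right {q : ℕ} (g : FormL2 q) {h : Space q → FormFiber q}
    (hh : MemLp h 2 volume) : inner ℂ g hh.toLp = ∫ x, inner ℂ (g x) (h x) := by
  rw [L2.inner_def]
  refine integral_congr_ae ?_
  filter_upwards [hh.coeFn_toLp] with x hx
  rw [hx]

theorem inner_schwartz_toLp_left {q : ℕ} (ψ : 𝓢(Space q, FormFiber q)) (g : FormL2 q) :
    inner ℂ (ψ.toLp 2) g = ∫ x, inner ℂ (ψ x) (g x) := by
  rw [L2.inner_def]
  have h := ψ.coeFn_toLp 2 volume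
  refine integral_congr_ae ?_
  filter_upwards [h] with x hx
  rw [hx]

/-- The distributional image of a square integrable form is its image. -/
theorem IsDistributionalImage.ae_eq {q : ℕ} {T : FormL2 q →L[ℂ] FormL2 q}
    {F u : Space q → FormFiber q} (h : IsDistributionalImage T F u) (hu : Continuous u)
    (hF : MemLp F 2 (volume : Measure (Space q))) : ∀ᵐ p, T hF.toLp p = u p := by
  have hTl : LocallyIntegrable (T hF.toLp) volume :=
    (Lp.memLp (T hF.toLp)).locallyIntegrable (by norm_num)
  refine ae_eq_of_integral_contDiff_smul_eq hTl hu.locallyIntegrable fun g hg hgs => ?_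
  have hi1 := hTl.integrable_smul_left_of_hasCompactSupport hg.continuous hgs
  have hi2 := hu.locallyIntegrable (μ := volume).integrable_smul_left_of_hasCompactSupport
    hg.continuous hgs
  -- Scalar bump functions g and constant vectors c reduce the vector-valued identity to the test
  -- forms g c.
  refine ext_inner_left ℂ fun c => ?_
  rw [← integral_inner hi1, ← integral_inner hi2]
  have hψs : HasCompactSupport fun x => g x • c := hgs.smul_right
  let ψ : 𝓢(Space q, FormFiber q) := hψs.toSchwartzMap (hg.smul contDiff_const)
  have hψ : ∀ x, ψ x = g x • c := fun x => rfl
  have h1 := (h ψ hψs).2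
  rw [← inner_memLp_toLp_right _ hF, ContinuousLinearMap.adjoint_inner_left,
    inner_schwartz_toLp_left] at h1
  simp only [hψ, ← Complex.coe_smul, inner_smul_left, Complex.conj_ofReal] at h1
  simpa only [← Complex.coe_smul, inner_smul_right] using h1

theorem mainTheorem3 (n : ℕ) (t : ℝ) (ht : 0 < t) :
    ∃ T : FormL2 (n + 1) →L[ℂ] FormL2 (n + 1),
      IsDeformedExtD t T ∧ (∀ T', IsDeformedExtD t T' → T' = T) ∧
      ∀ f : Space (n + 1) → Space (n + 1) [⋀^Fin n]→L[ℝ] ℂ, Continuous f →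
        ∃ u : Space (n + 1) → FormFiber (n + 1),
          Continuous u ∧
          (∀ p, u p = volForm (((n + 1 : ℕ) : ℂ) * averageFlux f t p)) ∧
          IsDistributionalImage T (fun x => formCoords (f x)) u ∧
          ∀ hf : MemLp (fun x => formCoords (f x)) 2 (volume : Measure (Space (n + 1))),
            ∀ᵐ p, T hf.toLp p = u p := by
  obtain ⟨C, hC⟩ := exists_norm_deformedSymbol_le (n := n) ht
  obtain ⟨T, hT⟩ := exists_isFourierMultiplier (continuous_deformedSymbol t) hC
  refine ⟨T, hT.isDeformedExtD, fun T' h => h.unique hT.isDeformedExtD, fun f hf => ?_⟩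
  have hF : Continuous fun x => formCoords (f x) := formCoords.continuous.comp hf
  have hu := continuous_sphereAverage t hF
  have hdist := isDistributionalImage_sphereAverage ht hT hF
  exact ⟨_, hu, sphereAverage_formCoords ht hf, hdist, fun hf2 => hdist.ae_eq hu hf2⟩
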